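/- **Setting.** Let $k$ be a field, $G$ a cyclic group of order $n$ with generator $g$, and assume that $k$ contains a primitive $n$-th root of unity $\zeta$. Let $Q$ be a finite quiver with source and target maps $\mathfrak s,\mathfrak t$ (paths are composed from right to left). Let $W$ be a finite potential on $Q$, i.e. a finite $k$-linear combination of cycles of length at least $3$, considered up to cyclic permutation, whose cyclic derivatives generate an admissible ideal of $kQ$. Let $\Lambda=\mathcal P(Q,W)$ be the Jacobian algebra, the quotient of the completed path algebra $\widehat{kQ}$ by the closure of the ideal generated by the cyclic derivatives of $W$. Let $G$ act on $kQ$ so that * $G$ permutes the vertices and maps every arrow to a nonzero multiple of an arrow; * every vertex which is not fixed by $G$ has an orbit of cardinality $n$; * $hW=W$ up to cyclic permutation, for all $h\in G$ (so $G$ acts on $\Lambda$); * every arrow $\alpha$ between two fixed vertices satisfies $g(\alpha)=\zeta^{b(\alpha)}\alpha$ for some $b(\alpha)\in\mathbb Z/n$, and all other arrows are sent to arrows by $G$; * every cycle of $W$ goes through no fixed vertex, or through exactly one fixed vertex, or through exactly one non-fixed vertex, or through fixed vertices only (counted with multiplicity). Let $\mathcal E$ be a set of representatives of the $G$-orbits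 of vertices, $\mathcal E'$ the set of its non-fixed and $\mathcal E''$ the set of its fixed vertices. Let $\Lambda G$ be the skew group algebra, $e_\mu=\frac1n\sum_{i=0}^{n-1}\zeta^{i\mu}g^i$ for $\mu\in\mathbb Z/n$, and $\eta=\sum_{\varepsilon\in\mathcal E}\varepsilon\otimes1\in\Lambda G$. **The quiver $Q_G$.** Its vertices are the idempotents $\eta^\varepsilon=\varepsilon\otimes 1$ ($\varepsilon\in\mathcal E'$) and $\eta^\varepsilon_\mu=\varepsilon\otimes e_\mu$ ($\varepsilon\in\mathcal E''$, $\mu\in\mathbb Z/n$) of $\eta(\Lambda G)\eta$. Its arrows are the following elements of $\eta(\Lambda G)\eta$: 1. for $\alpha\colon g^{t}\varepsilon\to\varepsilon'$ with $\varepsilon,\varepsilon'\in\mathcal E'$ (type (1), $t(\alpha):=t\in\mathbb Z/n$): $\tilde\alpha=\alpha\otimes g^{t}\colon\eta^\varepsilon\to\eta^{\varepsilon'}$; 2. for $\alpha\colon\varepsilon\to\varepsilon'$ with $\varepsilon\in\mathcal E'$, $\varepsilon'\in\mathcal E''$ (type (2)) and $\mu\in\mathbb Z/n$: $\tilde\alpha^\mu=(1\otimes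 e_\mu)(\alpha\otimes1)\colon\eta^\varepsilon\to\eta^{\varepsilon'}_\mu$; 3. for $\alpha\colon\varepsilon\to\varepsilon'$ with $\varepsilon\in\mathcal E''$, $\varepsilon'\in\mathcal E'$ (type (3)) and $\mu\in\mathbb Z/n$: $\tilde\alpha^\mu=\alpha\otimes e_\mu\colon\eta^\varepsilon_\mu\to\eta^{\varepsilon'}$; 4. for $\alpha\colon\varepsilon\to\varepsilon'$ with $\varepsilon,\varepsilon'\in\mathcal E''$ (type (4)) and $\mu\in\mathbb Z/n$: $\tilde\alpha^\mu=\alpha\otimes e_\mu\colon\eta^\varepsilon_\mu\to\eta^{\varepsilon'}_{\mu-b(\alpha)}$. **The dual action.** The dual group $\hat G=\operatorname{Hom}(G,k^*)$, generated by $\chi$ with $\chi(g)=\zeta$, acts on $\Lambda G$ by $\psi(\lambda\otimes h)=\psi(h)\lambda\otimes h$. This action restricts to $\eta(\Lambda G)\eta$; on $Q_G$ it fixes the vertices $\eta^\varepsilon$ and permutes the vertices $\eta^\varepsilon_\mu$ with orbits of cardinality $n$ (so for $n>1$ the latter are the non-fixed ones). It satisfies $\chi(\eta^\varepsilon_\mu)=\eta^\varepsilon_{\mu+1}$,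 $\chi(\tilde\alpha)=\zeta^{t(\alpha)}\tilde\alpha$ and $\chi(\tilde\alpha^\mu)=\tilde\alpha^{\mu+1}$. Choose the orbit representatives $\mathcal E_G=\{\eta^\varepsilon_0\mid\varepsilon\in\mathcal E''\}\cup\{\eta^\varepsilon\mid\varepsilon\in\mathcal E'\}$, and put $\theta=\sum_{s\in\mathcal E_G}s\otimes1\in(\eta(\Lambda G)\eta)\hat G$. The construction above, applied to $Q_G$, $\hat G$, $\chi$, $\mathcal E_G$, gives the quiver $(Q_G)_{\hat G}$. With $e_\nu=\frac1n\sum_i\zeta^{i\nu}\chi^i$ its vertices are the elements $\eta^\varepsilon_0\otimes1$ ($\varepsilon\in\mathcal E''$) and $\eta^\varepsilon\otimes e_\nu$ ($\varepsilon\in\mathcal E'$, $\nu\in\mathbb Z/n$) of $\theta((\eta(\Lambda G)\eta)\hat G)\theta$, and its arrows are the following elements of that algebra: 1. $\tilde\beta=\beta\otimes\chi^{b(\alpha)}$ with $\beta=\tilde\alpha^{b(\alpha)}$, $\alpha$ of type (4); 2. $\tilde\beta^\nu=(1\otimes e_\nu)(\beta\otimes1)$ with $\beta=\tilde\alpha^0$,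 $\alpha$ of type (3), $\nu\in\mathbb Z/n$; 3. $\tilde\beta^\nu=\beta\otimes e_\nu$ with $\beta=\tilde\alpha^0$, $\alpha$ of type (2), $\nu\in\mathbb Z/n$; 4. $\tilde\beta^\nu=\beta\otimes e_\nu$ with $\beta=\tilde\alpha$, $\alpha$ of type (1), $\nu\in\mathbb Z/n$. Let $\phi\colon(Q_G)_{\hat G}\to Q$ be defined on vertices by $\phi(\eta^\varepsilon_0\otimes1)=\varepsilon$ and $\phi(\eta^\varepsilon\otimes e_\nu)=g^\nu(\varepsilon)$, and on the arrows listed under 1, 2, 3, 4 by $\phi(\tilde\beta)=\alpha$, $\phi(\tilde\beta^\nu)=g^\nu(\alpha)$, $\phi(\tilde\beta^\nu)=g^\nu(\alpha)$ and $\phi(\tilde\beta^\nu)=g^{\nu-t(\alpha)}(\alpha)$ respectively. **Claim.** $\phi$ is an isomorphism of quivers, and it induces an isomorphism of $k$-algebras $$\Psi\colon\ \theta\bigl((\eta(\Lambda G)\eta)\hat G\bigr)\theta\ \xrightarrow{\ \cong\ }\ \Lambda=\mathcal P(Q,W)$$ in the following sense: $\Psi(s)$ is the idempotent of $\Lambda$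 at the vertex $\phi(s)$ for every vertex $s$ of $(Q_G)_{\hat G}$; $\Psi(\gamma)$ is the class of the arrow $\phi(\gamma)$ for the arrows $\gamma$ of $(Q_G)_{\hat G}$ listed under 1, 2 and 4; and $\Psi(\gamma)$ is $\frac1n$ times the class of $\phi(\gamma)$ for the arrows $\gamma$ listed under 3. -/

import Mathlib

set_option linter.unusedSectionVars false
universe u w z

noncomputable section

/-- A quiver: vertices `V`, arrows `A`, source `s` and target `t`. -/
structure Quiv where
  V : Type u
  A : Type u
  s : A → V
  t : A → V

namespace Quiv

variable (Q : Quiv.{u})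

/-- Arrows are composed from right to left: the list `[α₁, …, αₗ]` is a path `α₁⋯αₗ` ending at `v`
if `t α₁ = v` and `s αᵢ = t αᵢ₊₁`. -/
def IsPath : Q.V → List Q.A → Prop
  | _, [] => True
  | v, a :: w => Q.t a = v ∧ IsPath (Q.s a) w

/-- The starting vertex of a path ending at `v`. -/
def start : Q.V → List Q.A → Q.V
  | v, [] => v
  | _, a :: w => start (Q.s a) w

/-- Paths `α₁⋯αₗ` of length `l ≥ 0`, with their end vertex (so there is one trivial path for every
vertex). -/
@[ext]
structure Path where
  tgt : Q.V
  arrows : List Q.A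
  isPath : Q.IsPath tgt arrows

variable {Q}

theorem isPath_append {v : Q.V} {w w' : List Q.A} :
    Q.IsPath v (w ++ w') ↔ Q.IsPath v w ∧ Q.IsPath (Q.start v w) w' := by
  induction w generalizing v with
  | nil => simp [IsPath, start]
  | cons a w ih => simp [IsPath, start, ih, and_assoc]

theorem start_append (v : Q.V) (w w' : List Q.A) :
    Q.start v (w ++ w') = Q.start (Q.start v w) w' := by
  induction w generalizing v with
  | nil => rfl
  | cons a w ih => simp [start, ih]

namespace Path

/-- The length of a path. -/
def length (p : Q.Path) : ℕ := p.arrows.length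

/-- The left factor `α₁⋯αᵢ` of `α₁⋯αₗ`. -/
def take (p : Q.Path) (i : ℕ) : Q.Path where
  tgt := p.tgt
  arrows := p.arrows.take i
  isPath := by
    have h := p.isPath
    rw [← List.take_append_drop i p.arrows, isPath_append] at h
    exact h.1

/-- The right factor `αᵢ₊₁⋯αₗ` of `α₁⋯αₗ`. -/
def drop (p : Q.Path) (i : ℕ) : Q.Path where
  tgt := Q.start p.tgt (p.arrows.take i)
  arrows := p.arrows.drop i
  isPath := by
    have h := p.isPath
    rw [← List.take_append_drop i p.arrows, isPath_append] at h
    exact h.2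

theorem take_take (p : Q.Path) {i j : ℕ} (h : j ≤ i) : (p.take i).take j = p.take j := by
  ext1
  · rfl
  · simp [take, List.take_take, h]

theorem drop_drop (p : Q.Path) (i j : ℕ) : (p.drop i).drop j = p.drop (i + j) := by
  ext1
  · simp [drop, List.take_add, start_append]
  · simp [drop]

theorem take_drop (p : Q.Path) (i j : ℕ) : (p.drop i).take j = (p.take (i + j)).drop i := by
  ext1
  · simp [take, drop, List.take_take]
  · simp [take, drop, List.drop_take]

theorem drop_zero (p : Q.Path) : p.drop 0 = p := by
  ext1 <;> simp [drop, start]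

theorem take_length (p : Q.Path) : p.take p.length = p := by
  ext1 <;> simp [take, length]

theorem length_take (p : Q.Path) (i : ℕ) : (p.take i).length = min i p.length := by
  simp [take, length]

theorem length_drop (p : Q.Path) (i : ℕ) : (p.drop i).length = p.length - i := by
  simp [drop, length]

end Path

end Quiv

/-- The completed path algebra `k̂Q` of a finite quiver, i.e. the completion of `kQ` with respect to
the `⟨Q₁⟩`-adic topology: its elements are the (possibly infinite) linear combinations `∑ₚ x(p) p`
of paths. -/
def CPA (k : Type*) (Q : Quiv.{u}) := Q.Path → k

namespace CPA

variable {k : Type*} [Field k] {Q : Quiv.{u}}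

instance : AddCommGroup (CPA k Q) := inferInstanceAs (AddCommGroup (Q.Path → k))

instance : Module k (CPA k Q) := inferInstanceAs (Module k (Q.Path → k))

@[ext] theorem ext {x y : CPA k Q} (h : ∀ p, x p = y p) : x = y := funext h

@[simp] theorem add_apply (x y : CPA k Q) (p : Q.Path) : (x + y) p = x p + y p := rfl
@[simp] theorem zero_apply (p : Q.Path) : (0 : CPA k Q) p = 0 := rfl
@[simp] theorem neg_apply (x : CPA k Q) (p : Q.Path) : (-x) p = -x p := rfl
@[simp] theorem smul_apply (c : k) (x : CPA k Q) (p : Q.Path) : (c • x) p = c * x p := rfl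

/-- The unit is the sum of all trivial paths. -/
instance : One (CPA k Q) := ⟨fun p => if p.length = 0 then 1 else 0⟩

/-- `xy = ∑_{q, r} x(q) y(r) qr`, i.e. the coefficient of `p` in `xy` is the sum of `x(q) y(r)` over
all factorizations `p = qr`. -/
instance : Mul (CPA k Q) :=
  ⟨fun x y p => ∑ i ∈ Finset.range (p.length + 1), x (p.take i) * y (p.drop i)⟩

theorem one_apply (p : Q.Path) : (1 : CPA k Q) p = if p.length = 0 then 1 else 0 := rfl

theorem mul_apply (x y : CPA k Q) (p : Q.Path) :
    (x * y) p = ∑ i ∈ Finset.range (p.length + 1), x (p.take i) * y (p.drop i) := rfl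

protected theorem mul_assoc (x y z : CPA k Q) : x * y * z = x * (y * z) := by
  ext p
  simp only [mul_apply, Finset.sum_mul, Finset.mul_sum]
  rw [Finset.sum_sigma', Finset.sum_sigma']
  refine Finset.sum_bij' (fun a _ => ⟨a.2, a.1 - a.2⟩) (fun a _ => ⟨a.1 + a.2, a.1⟩) ?_ ?_ ?_ ?_ ?_
  · rintro ⟨i, j⟩ h
    simp only [Finset.mem_sigma, Finset.mem_range, Quiv.Path.length_take,
      Quiv.Path.length_drop] at h ⊢
    omega
  · rintro ⟨i, j⟩ h
    simp only [Finset.mem_sigma, Finset.mem_range, Quiv.Path.length_take,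
      Quiv.Path.length_drop] at h ⊢
    omega
  · rintro ⟨i, j⟩ h
    simp only [Finset.mem_sigma, Finset.mem_range, Quiv.Path.length_take] at h
    have : j + (i - j) = i := by omega
    simp [this]
  · rintro ⟨i, j⟩ h
    simp
  · rintro ⟨i, j⟩ h
    simp only [Finset.mem_sigma, Finset.mem_range, Quiv.Path.length_take] at h
    have hij : j + (i - j) = i := by omega
    simp only [Quiv.Path.take_drop, Quiv.Path.drop_drop, hij]
    rw [Quiv.Path.take_take p (by omega : j ≤ i), mul_assoc]

protected theorem one_mul (x : CPA k Q) : 1 * x = x := by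
  ext p
  rw [mul_apply, Finset.sum_eq_single 0]
  · simp [one_apply, Quiv.Path.length_take, Quiv.Path.drop_zero]
  · intro i hi h0
    have : (p.take i).length ≠ 0 := by
      rw [Quiv.Path.length_take]; rw [Finset.mem_range] at hi; omega
    simp [one_apply, this]
  · simp

protected theorem mul_one (x : CPA k Q) : x * 1 = x := by
  ext p
  rw [mul_apply, Finset.sum_eq_single p.length]
  · simp [one_apply, Quiv.Path.length_drop, Quiv.Path.take_length]
  · intro i hi h0
    have : (p.drop i).length ≠ 0 := by
      rw [Quiv.Path.length_drop]; rw [Finset.mem_range] at hi; omega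
    simp [one_apply, this]
  · simp

instance : Ring (CPA k Q) :=
  { (inferInstance : AddCommGroup (CPA k Q)) with
    mul := (· * ·)
    one := 1
    mul_assoc := CPA.mul_assoc
    one_mul := CPA.one_mul
    mul_one := CPA.mul_one
    left_distrib := fun x y z => by
      ext p; simp [mul_apply, mul_add, Finset.sum_add_distrib]
    right_distrib := fun x y z => by
      ext p; simp [mul_apply, add_mul, Finset.sum_add_distrib]
    zero_mul := fun x => by ext p; simp [mul_apply]
    mul_zero := fun x => by ext p; simp [mul_apply] }

instance : Algebra k (CPA k Q) :=
  Algebra.ofModule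
    (fun c x y => by ext p; simp [mul_apply, Finset.mul_sum, mul_assoc])
    (fun c x y => by ext p; simp [mul_apply, Finset.mul_sum, mul_left_comm])

open Classical in
/-- A path, as an element of the completed path algebra. -/
def ofPath (p : Q.Path) : CPA k Q := fun q => if q = p then 1 else 0

/-- The trivial path at `v`. -/
def vertex (v : Q.V) : CPA k Q := ofPath ⟨v, [], trivial⟩

/-- An arrow, as a path of length one. -/
def arrow (a : Q.A) : CPA k Q := ofPath ⟨Q.t a, [a], rfl, trivial⟩

theorem vertex_apply (v : Q.V) (p : Q.Path) (h : p.length = 0) (hv : p.tgt = v) :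
    (vertex v : CPA k Q) p = 1 := by
  rw [vertex, ofPath, if_pos]
  ext1
  · exact hv
  · exact List.length_eq_zero_iff.1 h

theorem vertex_eq_zero (v : Q.V) (p : Q.Path) (h : ¬(p.tgt = v ∧ p.length = 0)) :
    (vertex v : CPA k Q) p = 0 := by
  rw [vertex, ofPath, if_neg]
  rintro rfl
  exact h ⟨rfl, rfl⟩

open Classical in
theorem vertex_mul_apply (v : Q.V) (x : CPA k Q) (p : Q.Path) :
    (vertex v * x : CPA k Q) p = if p.tgt = v then x p else 0 := by
  rw [mul_apply, Finset.sum_eq_single 0]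
  · rw [Quiv.Path.drop_zero]
    split_ifs with h
    · have h1 := vertex_apply (k := k) v (p.take 0) (by rw [Quiv.Path.length_take]; simp) h
      exact (congrArg (· * x p) h1).trans (one_mul _)
    · have h1 := vertex_eq_zero (k := k) v (p.take 0) (fun h' => h h'.1)
      exact (congrArg (· * x p) h1).trans (zero_mul _)
  · intro i hi h0
    rw [vertex_eq_zero, zero_mul]
    rintro ⟨_, h⟩
    rw [Quiv.Path.length_take] at h; rw [Finset.mem_range] at hi; omega
  · simp

open Classical in
theorem mul_vertex_apply (v : Q.V) (x : CPA k Q) (p : Q.Path) :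
    (x * vertex v : CPA k Q) p = if Q.start p.tgt p.arrows = v then x p else 0 := by
  have hd : (p.drop p.length).tgt = Q.start p.tgt p.arrows := by
    simp [Quiv.Path.drop, Quiv.Path.length]
  rw [mul_apply, Finset.sum_eq_single p.length]
  · rw [Quiv.Path.take_length]
    split_ifs with h
    · rw [vertex_apply _ _ (by simp [Quiv.Path.length_drop]) (hd.trans h), mul_one]
    · rw [vertex_eq_zero _ _ (fun h' => h (hd.symm.trans h'.1)), mul_zero]
  · intro i hi h0
    rw [vertex_eq_zero, mul_zero]
    rintro ⟨_, h⟩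
    rw [Quiv.Path.length_drop] at h; rw [Finset.mem_range] at hi; omega
  · simp

end CPA

end

noncomputable section

namespace Quiv

variable (k : Type*) [Field k] {Q : Quiv.{u}}

open Classical in
/-- `d_α` on words: `d_α (α w) = w`, and `d_α` vanishes on words that do not end with `α`. -/
def strip (α : Q.A) : List Q.A → CPA k Q
  | [] => 0
  | β :: w => if β = α then (w.map CPA.arrow).prod else 0

variable {k}

/-- The cyclic derivative `∂_α W` of a finite linear combination `W` of cycles, which are considered
up to cyclic permutation:
`∂_α (α₁⋯αₗ) = ∑ₘ d_α (αₘ⋯αₗα₁⋯αₘ₋₁)`. -/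
def cyclicDeriv (W : Cycle Q.A →₀ k) (α : Q.A) : CPA k Q :=
  W.sum fun c r => r • (c.lists.map (strip k α)).sum

/-- A finite potential: a finite linear combination of cycles of `Q` (up to cyclic permutation)
of length at least `3`. -/
def IsPotential (W : Cycle Q.A →₀ k) : Prop :=
  ∀ c ∈ W.support, c.Chain (fun a b => Q.s a = Q.t b) ∧ 3 ≤ c.length

/-- The two-sided ideal of `kQ` (the span of the paths) generated by the cyclic derivatives of `W`,
viewed in `k̂Q`. -/
def derivIdeal (W : Cycle Q.A →₀ k) : Submodule k (CPA k Q) :=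
  Submodule.span k
    {x | ∃ (p q : Q.Path) (α : Q.A), x = CPA.ofPath p * cyclicDeriv W α * CPA.ofPath q}

/-- The ideal of `kQ` generated by the cyclic derivatives of `W` is admissible: it contains all
paths of length at least `N` for some `N ≥ 2`, and all its elements are combinations of paths of
length at least `2`. -/
def IsAdmissible (W : Cycle Q.A →₀ k) : Prop :=
  (∃ N, 2 ≤ N ∧ ∀ p : Q.Path, N ≤ p.length → CPA.ofPath p ∈ derivIdeal W) ∧
    ∀ x ∈ derivIdeal W, ∀ p : Q.Path, p.length < 2 → x p = 0

end Quiv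

namespace CPA

variable {k : Type*} [Field k] {Q : Quiv.{u}}

theorem mul_congr {x x' y y' : CPA k Q} {N : ℕ} (hx : ∀ p : Q.Path, p.length < N → x p = x' p)
    (hy : ∀ p : Q.Path, p.length < N → y p = y' p) (p : Q.Path) (hp : p.length < N) :
    (x * y) p = (x' * y') p := by
  rw [mul_apply, mul_apply]
  refine Finset.sum_congr rfl fun i _ => ?_
  rw [hx _ (by rw [Quiv.Path.length_take]; omega), hy _ (by rw [Quiv.Path.length_drop]; omega)]

/-- The closure of a two-sided ideal of `k̂Q` in the `⟨Q₁⟩`-adic topology. -/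
def closure (I : TwoSidedIdeal (CPA k Q)) : TwoSidedIdeal (CPA k Q) :=
  TwoSidedIdeal.mk' {x | ∀ N : ℕ, ∃ y ∈ I, ∀ p : Q.Path, p.length < N → x p = y p}
    (fun _ => ⟨0, I.zero_mem, fun _ _ => rfl⟩)
    (fun {x y} hx hy N => by
      obtain ⟨x', hx', hx⟩ := hx N
      obtain ⟨y', hy', hy⟩ := hy N
      exact ⟨x' + y', I.add_mem hx' hy', fun p hp => by simp [hx p hp, hy p hp]⟩)
    (fun {x} hx N => by
      obtain ⟨x', hx', hx⟩ := hx N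
      exact ⟨-x', I.neg_mem hx', fun p hp => by simp [hx p hp]⟩)
    (fun {x y} hy N => by
      obtain ⟨y', hy', hy⟩ := hy N
      exact ⟨x * y', I.mul_mem_left _ _ hy', mul_congr (fun _ _ => rfl) hy⟩)
    (fun {x y} hx N => by
      obtain ⟨x', hx', hx⟩ := hx N
      exact ⟨x' * y, I.mul_mem_right _ _ hx', mul_congr hx (fun _ _ => rfl)⟩)

theorem mem_closure {I : TwoSidedIdeal (CPA k Q)} {x : CPA k Q} :
    x ∈ closure I ↔ ∀ N : ℕ, ∃ y ∈ I, ∀ p : Q.Path, p.length < N → x p = y p :=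
  TwoSidedIdeal.mem_mk' _ _ _ _ _ _ _

end CPA

/-- The closure of the ideal generated by the cyclic derivatives of `W`. -/
def jacobianIdeal {k : Type*} [Field k] {Q : Quiv.{u}} (W : Cycle Q.A →₀ k) :
    TwoSidedIdeal (CPA k Q) :=
  CPA.closure (TwoSidedIdeal.span (Set.range (Quiv.cyclicDeriv W)))

/-- An action of `G` on the quiver algebra that permutes the vertices and maps every arrow to a
nonzero multiple of an arrow: `h(v) = onV h v` and `h(α) = coeff h α • onA h α`. -/
structure MonomialAction (k : Type*) [Field k] (G : Type*) [Group G] (Q : Quiv.{u}) where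
  onV : G → Q.V → Q.V
  onA : G → Q.A → Q.A
  coeff : G → Q.A → kˣ
  onV_one : ∀ v, onV 1 v = v
  onV_mul : ∀ h h' v, onV (h * h') v = onV h (onV h' v)
  onA_one : ∀ a, onA 1 a = a
  onA_mul : ∀ h h' a, onA (h * h') a = onA h (onA h' a)
  coeff_one : ∀ a, coeff 1 a = 1
  coeff_mul : ∀ h h' a, coeff (h * h') a = coeff h (onA h' a) * coeff h' a
  s_onA : ∀ h a, Q.s (onA h a) = onV h (Q.s a)
  t_onA : ∀ h a, Q.t (onA h a) = onV h (Q.t a)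

namespace MonomialAction

variable {k : Type*} [Field k] {G : Type*} [Group G] {Q : Quiv.{u}} (σ : MonomialAction k G Q)

theorem isPath_map (h : G) {v : Q.V} {w : List Q.A} (hw : Q.IsPath v w) :
    Q.IsPath (σ.onV h v) (w.map (σ.onA h)) := by
  induction w generalizing v with
  | nil => trivial
  | cons a w ih => exact ⟨by rw [σ.t_onA, hw.1], by rw [σ.s_onA]; exact ih hw.2⟩

theorem start_map (h : G) (v : Q.V) (w : List Q.A) :
    Q.start (σ.onV h v) (w.map (σ.onA h)) = σ.onV h (Q.start v w) := by
  induction w generalizing v with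
  | nil => rfl
  | cons a w ih => simp [Quiv.start, ← ih, σ.s_onA]

/-- The scalar by which `h` acts on a word. -/
def coeffWord (h : G) (w : List Q.A) : kˣ := (w.map (σ.coeff h)).prod

theorem coeffWord_one (w : List Q.A) : σ.coeffWord 1 w = 1 := by
  induction w with
  | nil => rfl
  | cons a w ih =>
    simp only [coeffWord, List.map_cons, List.prod_cons] at ih ⊢
    rw [ih, σ.coeff_one, one_mul]

theorem coeffWord_mul (h h' : G) (w : List Q.A) :
    σ.coeffWord (h * h') w = σ.coeffWord h (w.map (σ.onA h')) * σ.coeffWord h' w := by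
  induction w with
  | nil => simp [coeffWord]
  | cons a w ih =>
    simp only [coeffWord, List.map_cons, List.prod_cons] at ih ⊢
    rw [ih, σ.coeff_mul]
    exact mul_mul_mul_comm _ _ _ _

/-- The permutation of paths underlying the action. -/
def onPath (h : G) (p : Q.Path) : Q.Path where
  tgt := σ.onV h p.tgt
  arrows := p.arrows.map (σ.onA h)
  isPath := σ.isPath_map h p.isPath

theorem length_onPath (h : G) (p : Q.Path) : (σ.onPath h p).length = p.length := by
  simp [onPath, Quiv.Path.length]

theorem onPath_one (p : Q.Path) : σ.onPath 1 p = p := by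
  ext1
  · simp [onPath, σ.onV_one]
  · have : σ.onA 1 = id := funext σ.onA_one
    simp [onPath, this]

theorem onPath_mul (h h' : G) (p : Q.Path) :
    σ.onPath (h * h') p = σ.onPath h (σ.onPath h' p) := by
  ext1
  · simp [onPath, σ.onV_mul]
  · have : σ.onA (h * h') = σ.onA h ∘ σ.onA h' := funext (σ.onA_mul h h')
    simp [onPath, this]

theorem take_onPath (h : G) (p : Q.Path) (i : ℕ) :
    (σ.onPath h p).take i = σ.onPath h (p.take i) := by
  ext1
  · rfl
  · simp [onPath, Quiv.Path.take]

theorem drop_onPath (h : G) (p : Q.Path) (i : ℕ) :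
    (σ.onPath h p).drop i = σ.onPath h (p.drop i) := by
  ext1
  · simp [onPath, Quiv.Path.drop, ← List.map_take, start_map]
  · simp [onPath, Quiv.Path.drop]

/-- The (continuous) extension of the action to `k̂Q`, determined by
`h(α₁⋯αₗ) = h(α₁)⋯h(αₗ)`. -/
def act (h : G) (x : CPA k Q) : CPA k Q := fun p =>
  (σ.coeffWord h (σ.onPath h⁻¹ p).arrows : k) * x (σ.onPath h⁻¹ p)

theorem act_apply_onPath (h : G) (x : CPA k Q) (p : Q.Path) :
    σ.act h x (σ.onPath h p) = σ.coeffWord h p.arrows * x p := by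
  rw [act, ← σ.onPath_mul, inv_mul_cancel, σ.onPath_one]

theorem ext_onPath (h : G) {x y : CPA k Q}
    (H : ∀ p, x (σ.onPath h p) = y (σ.onPath h p)) : x = y := by
  ext p
  have := H (σ.onPath h⁻¹ p)
  rwa [← σ.onPath_mul, mul_inv_cancel, σ.onPath_one] at this

theorem act_one (x : CPA k Q) : σ.act 1 x = x := by
  refine σ.ext_onPath 1 fun p => ?_
  rw [act_apply_onPath, σ.onPath_one, coeffWord_one]; simp

theorem act_mul (h h' : G) (x : CPA k Q) : σ.act (h * h') x = σ.act h (σ.act h' x) := by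
  refine σ.ext_onPath (h * h') fun p => ?_
  rw [act_apply_onPath, σ.onPath_mul, act_apply_onPath, act_apply_onPath, coeffWord_mul]
  simp [onPath, mul_assoc]

/-- The action of `h` as an algebra endomorphism. -/
def actHom (h : G) : CPA k Q →ₐ[k] CPA k Q where
  toFun := σ.act h
  map_one' := by
    refine σ.ext_onPath h fun p => ?_
    rw [act_apply_onPath, CPA.one_apply, CPA.one_apply, length_onPath]
    split_ifs with hp
    · rw [Quiv.Path.length, List.length_eq_zero_iff] at hp
      simp [hp, coeffWord]
    · simp
  map_mul' x y := by
    refine σ.ext_onPath h fun p => ?_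
    rw [act_apply_onPath, CPA.mul_apply, CPA.mul_apply, length_onPath, Finset.mul_sum]
    refine Finset.sum_congr rfl fun i _ => ?_
    rw [take_onPath, drop_onPath, act_apply_onPath, act_apply_onPath]
    have : p.arrows = (p.take i).arrows ++ (p.drop i).arrows := by
      simp [Quiv.Path.take, Quiv.Path.drop]
    rw [this]
    simp only [coeffWord, List.map_append, List.prod_append, Units.val_mul]
    ring
  map_zero' := by ext p; simp [act]
  map_add' x y := by ext p; simp [act, mul_add]
  commutes' c := by
    refine σ.ext_onPath h fun p => ?_
    rw [act_apply_onPath, Algebra.algebraMap_eq_smul_one, CPA.smul_apply, CPA.smul_apply,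
      CPA.one_apply, CPA.one_apply, length_onPath]
    split_ifs with hp
    · rw [Quiv.Path.length, List.length_eq_zero_iff] at hp
      simp [hp, coeffWord]
    · simp

theorem actHom_ofPath (h : G) (p : Q.Path) :
    σ.actHom h (CPA.ofPath p) = (σ.coeffWord h p.arrows : k) • CPA.ofPath (σ.onPath h p) := by
  refine σ.ext_onPath h fun q => ?_
  have hinj : σ.onPath h q = σ.onPath h p ↔ q = p := by
    refine ⟨fun e => ?_, fun e => by rw [e]⟩
    have := congrArg (σ.onPath h⁻¹) e
    rwa [← σ.onPath_mul, ← σ.onPath_mul, inv_mul_cancel, σ.onPath_one, σ.onPath_one] at this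
  rw [CPA.smul_apply]
  change σ.act h _ _ = _
  rw [act_apply_onPath]
  by_cases e : q = p
  · simp [CPA.ofPath, e]
  · simp [CPA.ofPath, hinj, e]

theorem actHom_vertex (h : G) (v : Q.V) :
    σ.actHom h (CPA.vertex v) = CPA.vertex (σ.onV h v) := by
  rw [CPA.vertex, actHom_ofPath]
  simp [coeffWord, onPath, CPA.vertex]

theorem actHom_arrow (h : G) (a : Q.A) :
    σ.actHom h (CPA.arrow a) = (σ.coeff h a : k) • CPA.arrow (σ.onA h a) := by
  rw [CPA.arrow, actHom_ofPath]
  simp [coeffWord, onPath, CPA.arrow, σ.t_onA]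

/-- The scalar by which `h` acts on a cycle. -/
def coeffCycle (h : G) (c : Cycle Q.A) : kˣ := (c.toMultiset.map (σ.coeff h)).prod

/-- The action of `G` on potentials. -/
def actPotential (h : G) (W : Cycle Q.A →₀ k) : Cycle Q.A →₀ k :=
  W.sum fun c r => Finsupp.single (c.map (σ.onA h)) ((σ.coeffCycle h c : k) * r)

theorem onA_injective (h : G) : Function.Injective (σ.onA h) := fun a b e => by
  have := congrArg (σ.onA h⁻¹) e
  rwa [← σ.onA_mul, ← σ.onA_mul, inv_mul_cancel, σ.onA_one, σ.onA_one] at this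

theorem actHom_word (h : G) (w : List Q.A) :
    σ.actHom h (w.map CPA.arrow).prod =
      (σ.coeffWord h w : k) • ((w.map (σ.onA h)).map CPA.arrow).prod := by
  induction w with
  | nil => simp [coeffWord]
  | cons a w ih =>
    have hc : (σ.coeffWord h (a :: w) : k) = σ.coeff h a * σ.coeffWord h w := by
      simp [coeffWord]
    rw [List.map_cons, List.prod_cons, map_mul, ih, actHom_arrow, List.map_cons, List.map_cons,
      List.prod_cons, hc, smul_mul_smul_comm]

theorem actHom_strip (h : G) (α : Q.A) (w : List Q.A) :
    (σ.coeff h α : k) • σ.actHom h (Quiv.strip k α w) =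
      (σ.coeffWord h w : k) • Quiv.strip k (σ.onA h α) (w.map (σ.onA h)) := by
  cases w with
  | nil => simp [Quiv.strip]
  | cons b w =>
    by_cases e : b = α
    · subst e
      simp [Quiv.strip, actHom_word, smul_smul, coeffWord]
    · simp [Quiv.strip, e, (σ.onA_injective h).eq_iff]

theorem cyclicPermutations_map {α β : Type*} (f : α → β) (l : List α) :
    (l.map f).cyclicPermutations = l.cyclicPermutations.map (List.map f) := by
  cases l with
  | nil => rfl
  | cons a l =>
    refine List.ext_getElem ?_ fun i _ _ => ?_
    · rw [List.map_cons, List.length_cyclicPermutations_cons, List.length_map, List.length_map,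
        List.length_cyclicPermutations_cons]
    · rw [List.getElem_map, List.getElem_cyclicPermutations, List.getElem_cyclicPermutations,
        List.map_rotate]

theorem actHom_cyc (h : G) (α : Q.A) (c : Cycle Q.A) :
    (σ.coeff h α : k) • σ.actHom h (c.lists.map (Quiv.strip k α)).sum =
      (σ.coeffCycle h c : k) •
        ((c.map (σ.onA h)).lists.map (Quiv.strip k (σ.onA h α))).sum := by
  induction c using Quotient.inductionOn' with
  | h l =>
    have hl : (Cycle.map (σ.onA h) (Quotient.mk'' l)) = ((l.map (σ.onA h) : List Q.A) : Cycle Q.A) :=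
      rfl
    have hl' : (Quotient.mk'' l : Cycle Q.A) = ((l : List Q.A) : Cycle Q.A) := rfl
    rw [hl, hl', Cycle.lists_coe, Cycle.lists_coe, Multiset.map_coe, Multiset.map_coe,
      Multiset.sum_coe, Multiset.sum_coe, map_list_sum, List.smul_sum, List.smul_sum,
      cyclicPermutations_map, List.map_map, List.map_map, List.map_map, List.map_map]
    congr 1
    refine List.map_congr_left fun w hw => ?_
    have hperm : w.Perm l := by
      by_cases hl0 : l = []
      · subst hl0; simp at hw; subst hw; rfl
      · exact (List.mem_cyclicPermutations_iff.1 hw).perm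
    have hcw : σ.coeffCycle h (l : Cycle Q.A) = σ.coeffWord h w := by
      simp only [coeffCycle, coeffWord, Cycle.coe_toMultiset, Multiset.map_coe,
        Multiset.prod_coe]
      exact ((hperm.map _).prod_eq).symm
    simp only [Function.comp_apply]
    rw [hcw]
    exact σ.actHom_strip h α w

theorem actHom_cyclicDeriv (h : G) (W : Cycle Q.A →₀ k) (α : Q.A) :
    (σ.coeff h α : k) • σ.actHom h (Quiv.cyclicDeriv W α) =
      Quiv.cyclicDeriv (σ.actPotential h W) (σ.onA h α) := by
  unfold actPotential Quiv.cyclicDeriv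
  rw [Finsupp.sum_sum_index (by simp) (by intros; rw [add_smul]), Finsupp.sum, map_sum,
    Finset.smul_sum, Finsupp.sum]
  refine Finset.sum_congr rfl fun c _ => ?_
  rw [Finsupp.sum_single_index (by simp), map_smul, smul_comm, actHom_cyc, smul_smul, mul_comm]

theorem actHom_mem_jacobianIdeal (W : Cycle Q.A →₀ k) (hW : ∀ h, σ.actPotential h W = W) (h : G)
    {x : CPA k Q} (hx : x ∈ jacobianIdeal W) : σ.actHom h x ∈ jacobianIdeal W := by
  set I := TwoSidedIdeal.span (Set.range (Quiv.cyclicDeriv W)) with hI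
  have key : ∀ y ∈ I, σ.actHom h y ∈ I := by
    have : I ≤ TwoSidedIdeal.comap (σ.actHom h) I := by
      rw [hI, TwoSidedIdeal.span_le]
      rintro _ ⟨α, rfl⟩
      have h1 := σ.actHom_cyclicDeriv h W α
      rw [hW] at h1
      have h2 : σ.actHom h (Quiv.cyclicDeriv W α) =
          algebraMap k (CPA k Q) ((σ.coeff h α : k)⁻¹) * Quiv.cyclicDeriv W (σ.onA h α) := by
        rw [← h1, ← Algebra.smul_def, smul_smul, inv_mul_cancel₀ (Units.ne_zero _), one_smul]
      rw [SetLike.mem_coe, TwoSidedIdeal.mem_comap, h2]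
      exact TwoSidedIdeal.mul_mem_left _ _ _ (TwoSidedIdeal.subset_span ⟨_, rfl⟩)
    intro y hy
    exact (TwoSidedIdeal.mem_comap _).1 (this hy)
  rw [jacobianIdeal, CPA.mem_closure] at hx ⊢
  intro N
  obtain ⟨y, hy, hxy⟩ := hx N
  refine ⟨σ.actHom h y, key y hy, fun p hp => ?_⟩
  change σ.act h x p = σ.act h y p
  rw [act, act, hxy _ (by rwa [length_onPath])]

end MonomialAction

end

noncomputable section

/-- The combinatorial setting: a quiver with a monomial action of `G` and a chosen set of
representatives `E` of the vertices. `N` is the set of vertices that are not fixed by `G`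
(for `G ≠ 1` the fields `free` and `fixed` say precisely this; for `G = 1`, where orbits of
cardinality `n` and of cardinality `1` are the same thing, any `N` is allowed). -/
structure SkewSetting (k : Type z) [Field k] (G : Type w) [Group G] where
  Q : Quiv.{u}
  σ : MonomialAction k G Q
  N : Set Q.V
  E : Set Q.V
  /-- vertices not in `N` are fixed -/
  fixed : ∀ v ∉ N, ∀ h, σ.onV h v = v
  /-- vertices in `N` have an orbit of cardinality `|G|` -/
  free : ∀ v ∈ N, ∀ h, σ.onV h v = v → h = 1
  /-- arrows between fixed vertices are mapped to multiples of themselves -/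
  arrow_fixed : ∀ a, Q.s a ∉ N → Q.t a ∉ N → ∀ h, σ.onA h a = a
  /-- arrows with at least one end which is not fixed are mapped to arrows -/
  coeff_eq_one : ∀ a, Q.s a ∈ N ∨ Q.t a ∈ N → ∀ h, σ.coeff h a = 1
  /-- `E` contains exactly one vertex of every orbit -/
  existsUnique_rep : ∀ v, ∃! ε, ε ∈ E ∧ ∃ h, σ.onV h ε = v

namespace SkewSetting

variable {k : Type z} [Field k] {G : Type w} [Group G] (D : SkewSetting.{u} k G)

/-- The representative in `E` of the orbit of `v`. -/
def rep (v : D.Q.V) : D.Q.V := (D.existsUnique_rep v).choose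

theorem rep_mem_E (v : D.Q.V) : D.rep v ∈ D.E := (D.existsUnique_rep v).choose_spec.1.1

/-- An element `h` of `G` with `h(rep v) = v`; it is unique if `v` is not fixed. -/
def pos (v : D.Q.V) : G := (D.existsUnique_rep v).choose_spec.1.2.choose

theorem onV_pos (v : D.Q.V) : D.σ.onV (D.pos v) (D.rep v) = v :=
  (D.existsUnique_rep v).choose_spec.1.2.choose_spec

theorem rep_eq {v ε : D.Q.V} (hε : ε ∈ D.E) (h : G) (e : D.σ.onV h ε = v) : D.rep v = ε :=
  ((D.existsUnique_rep v).choose_spec.2 ε ⟨hε, h, e⟩).symm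

theorem onV_mem_N {v : D.Q.V} (h : G) : D.σ.onV h v ∈ D.N ↔ v ∈ D.N := by
  have key : ∀ (h : G) (v : D.Q.V), D.σ.onV h v ∈ D.N → v ∈ D.N := by
    intro h v hv
    by_contra hn
    rw [D.fixed v hn] at hv
    exact hn hv
  refine ⟨key h v, fun hv => key h⁻¹ _ ?_⟩
  rwa [← D.σ.onV_mul, inv_mul_cancel, D.σ.onV_one]

theorem rep_mem_N {v : D.Q.V} (hv : v ∈ D.N) : D.rep v ∈ D.N := by
  rw [← D.onV_mem_N (D.pos v), D.onV_pos]; exact hv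

theorem mem_E_of_fixed {v : D.Q.V} (hv : v ∉ D.N) : v ∈ D.E := by
  have h := D.fixed (D.rep v) (fun h => hv (by
    rw [← D.onV_pos v, D.onV_mem_N]; exact h)) (D.pos v)
  rw [D.onV_pos] at h
  rw [h]; exact D.rep_mem_E v

/-- The vertices of `Q_G`: a vertex `η^ε` for every `ε ∈ E` which is not fixed, and
vertices `η^ε_χ`, where `χ` runs over the characters of `G`, for every fixed vertex `ε`
(fixed vertices automatically belong to `E`). For a generator `g` of `G` and a primitive root of
unity `ζ`, the number `μ` corresponds to the character `χ` with `χ(g) = ζ^μ`. -/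
inductive Vertex : Type (max u w z)
  | moved (ε : D.Q.V) (hE : ε ∈ D.E) (hN : ε ∈ D.N)
  | fixed (ε : D.Q.V) (hN : ε ∉ D.N) (χ : G →* kˣ)

/-- The arrows of `Q_G`: `α̃` for the arrows `α` of type (1), and `α̃^χ` for the arrows `α` of
type (2), (3), (4) and the characters `χ` of `G`. -/
inductive Arrow : Type (max u w z)
  | one (α : D.Q.A) (hs : D.Q.s α ∈ D.N) (ht : D.Q.t α ∈ D.N) (hE : D.Q.t α ∈ D.E)
  | two (α : D.Q.A) (hs : D.Q.s α ∈ D.N) (ht : D.Q.t α ∉ D.N) (hE : D.Q.s α ∈ D.E) (χ : G →* kˣ)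
  | three (α : D.Q.A) (hs : D.Q.s α ∉ D.N) (ht : D.Q.t α ∈ D.N) (hE : D.Q.t α ∈ D.E) (χ : G →* kˣ)
  | four (α : D.Q.A) (hs : D.Q.s α ∉ D.N) (ht : D.Q.t α ∉ D.N) (χ : G →* kˣ)

/-- The character `b(α)` by which `G` acts on an arrow `α` between fixed vertices. -/
def b (α : D.Q.A) (hs : D.Q.s α ∉ D.N) (ht : D.Q.t α ∉ D.N) : G →* kˣ where
  toFun h := D.σ.coeff h α
  map_one' := D.σ.coeff_one α
  map_mul' h h' := by rw [D.σ.coeff_mul, D.arrow_fixed α hs ht]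

/-- The quiver `Q_G`. -/
def skewQuiv : Quiv.{max u w z} where
  V := D.Vertex
  A := D.Arrow
  s
    | .one α hs _ _ => .moved (D.rep (D.Q.s α)) (D.rep_mem_E _) (D.rep_mem_N hs)
    | .two α hs _ hE _ => .moved (D.Q.s α) hE hs
    | .three α hs _ _ χ => .fixed (D.Q.s α) hs χ
    | .four α hs _ χ => .fixed (D.Q.s α) hs χ
  t
    | .one α _ ht hE => .moved (D.Q.t α) hE ht
    | .two α _ ht _ χ => .fixed (D.Q.t α) ht χ
    | .three α _ ht hE _ => .moved (D.Q.t α) hE ht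
    | .four α hs ht χ => .fixed (D.Q.t α) ht (χ * (D.b α hs ht)⁻¹)

/-- The action of the dual group `Ĝ` on `Q_G`: a character `ψ` maps `η^ε_χ` to `η^ε_{ψχ}`, `α̃^χ` to
`α̃^{ψχ}`, and multiplies `α̃` by `ψ(t(α))` for `α` of type (1). -/
def dualAction : MonomialAction k (G →* kˣ) D.skewQuiv where
  onV
    | _, .moved ε hE hN => .moved ε hE hN
    | ψ, .fixed ε hN χ => .fixed ε hN (ψ * χ)
  onA
    | _, .one α hs ht hE => .one α hs ht hE
    | ψ, .two α hs ht hE χ => .two α hs ht hE (ψ * χ)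
    | ψ, .three α hs ht hE χ => .three α hs ht hE (ψ * χ)
    | ψ, .four α hs ht χ => .four α hs ht (ψ * χ)
  coeff
    | ψ, .one α _ _ _ => ψ (D.pos (D.Q.s α))
    | _, _ => 1
  onV_one v := by
    cases v with
    | moved => rfl
    | fixed ε hN χ => exact congrArg (Vertex.fixed ε hN) (one_mul χ)
  onV_mul h h' v := by
    cases v with
    | moved => rfl
    | fixed ε hN χ => exact congrArg (Vertex.fixed ε hN) (mul_assoc h h' χ)
  onA_one a := by
    cases a with
    | one => rfl
    | two α hs ht hE χ => exact congrArg (Arrow.two α hs ht hE) (one_mul χ)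
    | three α hs ht hE χ => exact congrArg (Arrow.three α hs ht hE) (one_mul χ)
    | four α hs ht χ => exact congrArg (Arrow.four α hs ht) (one_mul χ)
  onA_mul h h' a := by
    cases a with
    | one => rfl
    | two α hs ht hE χ => exact congrArg (Arrow.two α hs ht hE) (mul_assoc h h' χ)
    | three α hs ht hE χ => exact congrArg (Arrow.three α hs ht hE) (mul_assoc h h' χ)
    | four α hs ht χ => exact congrArg (Arrow.four α hs ht) (mul_assoc h h' χ)
  coeff_one a := by cases a <;> simp
  coeff_mul h h' a := by cases a <;> simp
  s_onA h a := by cases a <;> rfl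
  t_onA h a := by
    cases a with
    | one => rfl
    | two => rfl
    | three => rfl
    | four α hs ht χ => exact congrArg (Vertex.fixed _ ht) (mul_assoc h χ _)

/-- The setting given by the action of `Ĝ` on `Q_G`, with the set of representatives
`E_G = {η^ε_1 | ε fixed} ∪ {η^ε | ε ∈ E not fixed}`. -/
def dual : SkewSetting.{max u w z} k (G →* kˣ) where
  Q := D.skewQuiv
  σ := D.dualAction
  N := {v | ∃ ε hN χ, v = Vertex.fixed ε hN χ}
  E := {v | (∃ ε hE hN, v = Vertex.moved ε hE hN) ∨ ∃ ε hN, v = Vertex.fixed ε hN 1}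
  fixed v hv h := by
    cases v with
    | moved => rfl
    | fixed ε hN χ => exact absurd ⟨ε, hN, χ, rfl⟩ hv
  free v hv h e := by
    obtain ⟨ε, hN, χ, rfl⟩ := hv
    have e' : h * χ = χ := (Vertex.fixed.inj e).2
    exact mul_eq_right.1 e'
  arrow_fixed a hs ht h := by
    cases a with
    | one => rfl
    | two α _ ht' _ χ => exact absurd ⟨_, ht', χ, rfl⟩ ht
    | three α hs' _ _ χ => exact absurd ⟨_, hs', χ, rfl⟩ hs
    | four α hs' _ χ => exact absurd ⟨_, hs', χ, rfl⟩ hs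
  coeff_eq_one a ha h := by
    cases a with
    | one => rcases ha with ⟨_, _, _, e⟩ | ⟨_, _, _, e⟩ <;> cases e
    | two => rfl
    | three => rfl
    | four => rfl
  existsUnique_rep v := by
    cases v with
    | moved ε hE hN =>
      refine ⟨.moved ε hE hN, ⟨Or.inl ⟨ε, hE, hN, rfl⟩, 1, rfl⟩, ?_⟩
      rintro v' ⟨_, h, e⟩
      cases v' with
      | moved => exact e
      | fixed => cases e
    | fixed ε hN χ =>
      refine ⟨.fixed ε hN 1, ⟨Or.inr ⟨ε, hN, rfl⟩, χ, congrArg (Vertex.fixed ε hN) (mul_one χ)⟩, ?_⟩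
      rintro v' ⟨hv', h, e⟩
      rcases hv' with ⟨ε', hE, hN', rfl⟩ | ⟨ε', hN', rfl⟩
      · cases e
      · cases e; rfl

/-! ### The elements of the skew group algebra corresponding to vertices and arrows of `Q_G` -/

open SkewMonoidAlgebra in
/-- The idempotent `1 ⊗ e_χ`, where `e_χ = |G|⁻¹ ∑_h χ(h) h`. -/
def charIdem (Λ : Type*) [Ring Λ] [Algebra k Λ] [MulSemiringAction G Λ] [SMulCommClass G k Λ]
    (χ : G →* kˣ) : SkewMonoidAlgebra Λ G :=
  (Nat.card G : k)⁻¹ • ∑ᶠ h : G, (χ h : k) • single h (1 : Λ)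

section elements

variable {Λ : Type*} [Ring Λ] [Algebra k Λ] [MulSemiringAction G Λ] [SMulCommClass G k Λ]
  (e : D.Q.V → Λ) (x : D.Q.A → Λ)

open SkewMonoidAlgebra

/-- `η = ∑_{ε ∈ E} ε ⊗ 1`. -/
def eta : SkewMonoidAlgebra Λ G := ∑ᶠ ε ∈ D.E, single 1 (e ε)

/-- `η^ε = ε ⊗ 1` and `η^ε_χ = ε ⊗ e_χ`. -/
def vertexElt : D.Vertex → SkewMonoidAlgebra Λ G
  | .moved ε _ _ => single 1 (e ε)
  | .fixed ε _ χ => single 1 (e ε) * charIdem Λ χ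

/-- `α̃ = α ⊗ t(α)` for `α` of type (1), `α̃^χ = (1 ⊗ e_χ)(α ⊗ 1)` for `α` of type (2), and
`α̃^χ = α ⊗ e_χ` for `α` of type (3) or (4). -/
def arrowElt : D.Arrow → SkewMonoidAlgebra Λ G
  | .one α _ _ _ => single (D.pos (D.Q.s α)) (x α)
  | .two α _ _ _ χ => charIdem Λ χ * single 1 (x α)
  | .three α _ _ _ χ => single 1 (x α) * charIdem Λ χ
  | .four α _ _ χ => single 1 (x α) * charIdem Λ χ

section idem

variable [Finite D.Q.V]

theorem eta_mul (he : ∀ u ∈ D.E, ∀ v ∈ D.E, u ≠ v → e u * e v = 0)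
    (he' : ∀ u ∈ D.E, e u * e u = e u) {v : D.Q.V} (hv : v ∈ D.E) :
    D.eta e * single 1 (e v) = single 1 (e v) := by
  rw [eta, finsum_mem_eq_finite_toFinset_sum _ (Set.toFinite D.E), Finset.sum_mul,
    Finset.sum_eq_single v]
  · rw [single_mul_single, one_smul, mul_one, he' v hv]
  · intro u hu huv
    rw [single_mul_single, one_smul, he u (by simpa using hu) v hv huv, single_zero]
  · intro h
    exact absurd (by simpa using hv) h

theorem mul_eta (he : ∀ u ∈ D.E, ∀ v ∈ D.E, u ≠ v → e u * e v = 0)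
    (he' : ∀ u ∈ D.E, e u * e u = e u) {v : D.Q.V} (hv : v ∈ D.E) :
    single 1 (e v) * D.eta e = single 1 (e v) := by
  rw [eta, finsum_mem_eq_finite_toFinset_sum _ (Set.toFinite D.E), Finset.mul_sum,
    Finset.sum_eq_single v]
  · rw [single_mul_single, one_smul, mul_one, he' v hv]
  · intro u hu huv
    rw [single_mul_single, one_smul, he v hv u (by simpa using hu) huv.symm, single_zero]
  · intro h
    exact absurd (by simpa using hv) h

theorem eta_idem (he : ∀ u ∈ D.E, ∀ v ∈ D.E, u ≠ v → e u * e v = 0)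
    (he' : ∀ u ∈ D.E, e u * e u = e u) : IsIdempotentElem (D.eta e) := by
  have h : D.eta e * D.eta e = D.eta e := by
    conv_lhs => rw [eta, finsum_mem_eq_finite_toFinset_sum _ (Set.toFinite D.E), Finset.sum_mul]
    conv_rhs => rw [eta, finsum_mem_eq_finite_toFinset_sum _ (Set.toFinite D.E)]
    refine Finset.sum_congr rfl fun u hu => ?_
    rw [← finsum_mem_eq_finite_toFinset_sum _ (Set.toFinite D.E)]
    exact D.mul_eta e he he' (by simpa using hu)
  exact h

end idem

end elements

end SkewSetting

end

noncomputable section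

/-! ### Corner algebras and the action of the dual group on a skew group algebra -/

section general

variable {k : Type*} [Field k] {B : Type*} [Ring B] [Algebra k B] {e : B}

/-- The corner `eBe` of a ring `B`, for an idempotent `e`; its unit is `e`. -/
def CornerAlg (B : Type*) [Ring B] (e : B) (h : IsIdempotentElem e) : Type _ := h.Corner

namespace CornerAlg

variable {h : IsIdempotentElem e}

instance : Ring (CornerAlg B e h) := inferInstanceAs (Ring h.Corner)

/-- The inclusion of `eBe` into `B`. -/
def val (x : CornerAlg B e h) : B := Subtype.val x

theorem mem_iff (h : IsIdempotentElem e) {x : B} : x ∈ Subsemigroup.corner e ↔ e * x = x ∧ x * e = x :=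
  Subsemigroup.mem_corner_iff h

instance : Module k (CornerAlg B e h) where
  smul c x := ⟨c • x.val, by
    have hx := (mem_iff h).1 x.2
    refine (mem_iff h).2 ⟨?_, ?_⟩
    · rw [mul_smul_comm]; exact congrArg (c • ·) hx.1
    · rw [smul_mul_assoc]; exact congrArg (c • ·) hx.2⟩
  one_smul x := Subtype.ext (one_smul k x.val)
  mul_smul c d x := Subtype.ext (mul_smul c d x.val)
  smul_zero c := Subtype.ext (smul_zero c)
  smul_add c x y := Subtype.ext (smul_add c x.val y.val)
  add_smul c d x := Subtype.ext (add_smul c d x.val)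
  zero_smul x := Subtype.ext (zero_smul k x.val)

instance : Algebra k (CornerAlg B e h) :=
  Algebra.ofModule (fun c x y => Subtype.ext (smul_mul_assoc c x.val y.val))
    (fun c x y => Subtype.ext (mul_smul_comm c x.val y.val))

end CornerAlg

variable {G : Type*} [Group G] {Λ : Type*} [Ring Λ] [Algebra k Λ] [MulSemiringAction G Λ]
  [SMulCommClass G k Λ]

open SkewMonoidAlgebra

/-- The action of a character `ψ` of `G` on the skew group algebra:
`ψ(λ ⊗ g) = ψ(g) λ ⊗ g`. -/
def dualHom (ψ : G →* kˣ) : SkewMonoidAlgebra Λ G →+* SkewMonoidAlgebra Λ G :=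
  liftNCRingHom singleOneRingHom
    { toFun := fun g => single g ((ψ g : k) • (1 : Λ))
      map_one' := by simp
      map_mul' := fun g h => by
        simp [single_mul_single, smul_comm g, smul_smul, mul_comm] }
    (fun {x y} => by
      simp [singleOneRingHom, singleAddHom, single_mul_single])

theorem dualHom_single (ψ : G →* kˣ) (g : G) (a : Λ) :
    dualHom (k := k) ψ (single g a) = single g ((ψ g : k) • a) := by
  simp [dualHom, liftNCRingHom, liftNC, singleOneRingHom, singleAddHom, single_mul_single]

theorem dualHom_one (x : SkewMonoidAlgebra Λ G) : dualHom (1 : G →* kˣ) x = x := by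
  induction x using SkewMonoidAlgebra.induction_on with
  | zero => simp
  | single g a => simp [dualHom_single]
  | add x y hx hy => rw [map_add, hx, hy]

theorem dualHom_mul (ψ ψ' : G →* kˣ) (x : SkewMonoidAlgebra Λ G) :
    dualHom (ψ * ψ') x = dualHom ψ (dualHom ψ' x) := by
  induction x using SkewMonoidAlgebra.induction_on with
  | zero => simp
  | single g a => simp [dualHom_single, smul_smul]
  | add x y hx hy => rw [map_add, hx, hy, map_add, map_add]

theorem dualHom_smul (ψ : G →* kˣ) (c : k) (x : SkewMonoidAlgebra Λ G) :
    dualHom ψ (c • x) = c • dualHom ψ x := by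
  induction x using SkewMonoidAlgebra.induction_on with
  | zero => simp
  | single g a => simp [dualHom_single, smul_single, smul_comm c]
  | add x y hx hy => rw [smul_add, map_add, hx, hy, map_add, smul_add]

end general

end

noncomputable section

open SkewMonoidAlgebra

/-- A quiver with potential with an action of `G` satisfying the standing assumptions, together with
the chosen set `E` of representatives of the vertices. -/
structure SkewQP (k : Type z) [Field k] (G : Type w) [Group G] extends SkewSetting.{u} k G where
  finite_V : Finite Q.V
  finite_A : Finite Q.A
  /-- the potential, a finite linear combination of cycles up to cyclic permutation -/
  W : Cycle Q.A →₀ k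
  isPotential : Quiv.IsPotential W
  isAdmissible : Quiv.IsAdmissible W
  invariant : ∀ h, σ.actPotential h W = W
  /-- every cycle of `W` goes through no fixed vertex, or through exactly one fixed vertex, or
  through exactly one vertex which is not fixed, or only through fixed vertices (counted with
  multiplicity) -/
  cycle_types : ∀ c ∈ W.support,
    Multiset.card (open Classical in (c.toMultiset.map Q.s).filter (· ∉ N)) = 0 ∨
    Multiset.card (open Classical in (c.toMultiset.map Q.s).filter (· ∉ N)) = 1 ∨
    Multiset.card (open Classical in (c.toMultiset.map Q.s).filter (· ∈ N)) = 1 ∨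
    Multiset.card (open Classical in (c.toMultiset.map Q.s).filter (· ∈ N)) = 0

namespace SkewQP

section

variable {k : Type z} [Field k] {G : Type w} [Group G] (S : SkewQP.{u} k G)

instance : Finite S.Q.V := S.finite_V
instance : Finite S.Q.A := S.finite_A

/-- The Jacobian algebra `Λ = 𝒫(Q, W)`: the quotient of the completed path algebra by the closure of
the ideal generated by the cyclic derivatives of `W`. -/
def Jac : Type (max u z) := (jacobianIdeal S.W).ringCon.Quotient

instance : Ring S.Jac := inferInstanceAs (Ring (jacobianIdeal S.W).ringCon.Quotient)
instance : Algebra k S.Jac := inferInstanceAs (Algebra k (jacobianIdeal S.W).ringCon.Quotient)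

/-- The quotient map `k̂Q → Λ`. -/
def proj : CPA k S.Q →+* S.Jac := (jacobianIdeal S.W).ringCon.mk'

theorem proj_surjective : Function.Surjective S.proj := RingCon.mk'_surjective _

theorem proj_smul (c : k) (x : CPA k S.Q) : S.proj (c • x) = c • S.proj x := rfl

theorem proj_eq {x y : CPA k S.Q} : S.proj x = S.proj y ↔ x - y ∈ jacobianIdeal S.W := by
  rw [← TwoSidedIdeal.rel_iff]
  exact RingCon.eq _

/-- The automorphism of `Λ` induced by the action of `h` on `k̂Q`. -/
def jacHom (h : G) : S.Jac →+* S.Jac :=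
  (jacobianIdeal S.W).ringCon.lift (S.proj.comp (S.σ.actHom h : CPA k S.Q →+* CPA k S.Q))
    (fun x y hxy => by
      rw [TwoSidedIdeal.rel_iff] at hxy
      have := S.σ.actHom_mem_jacobianIdeal S.W S.invariant h hxy
      rw [map_sub] at this
      exact S.proj_eq.2 this)

theorem jacHom_proj (h : G) (x : CPA k S.Q) : S.jacHom h (S.proj x) = S.proj (S.σ.act h x) := rfl

/-- The induced action of `G` on `Λ`. -/
instance : MulSemiringAction G S.Jac where
  smul h := S.jacHom h
  one_smul x := by
    obtain ⟨x, rfl⟩ := S.proj_surjective x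
    exact (S.jacHom_proj 1 x).trans (congrArg S.proj (S.σ.act_one x))
  mul_smul h h' x := by
    obtain ⟨x, rfl⟩ := S.proj_surjective x
    exact (S.jacHom_proj _ x).trans (congrArg S.proj (S.σ.act_mul h h' x))
  smul_zero h := map_zero (S.jacHom h)
  smul_add h := map_add (S.jacHom h)
  smul_one h := map_one (S.jacHom h)
  smul_mul h := map_mul (S.jacHom h)

theorem smul_proj (h : G) (x : CPA k S.Q) : h • S.proj x = S.proj (S.σ.act h x) := rfl

instance : SMulCommClass G k S.Jac where
  smul_comm h c x := by
    obtain ⟨x, rfl⟩ := S.proj_surjective x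
    rw [← S.proj_smul, smul_proj, smul_proj, ← S.proj_smul]
    exact congrArg S.proj (map_smul (S.σ.actHom h) c x)

/-- The idempotent of `Λ` at a vertex. -/
def vert (v : S.Q.V) : S.Jac := S.proj (CPA.vertex v)

/-- The element of `Λ` given by an arrow. -/
def arr (a : S.Q.A) : S.Jac := S.proj (CPA.arrow a)

theorem smul_vert (h : G) (v : S.Q.V) : h • S.vert v = S.vert (S.σ.onV h v) := by
  rw [vert, smul_proj]
  exact congrArg S.proj (S.σ.actHom_vertex h v)

theorem vert_mul_self (v : S.Q.V) : S.vert v * S.vert v = S.vert v := by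
  rw [vert, ← map_mul]
  congr 1
  ext p
  rw [CPA.vertex_mul_apply]
  split_ifs with h
  · rfl
  · exact (CPA.vertex_eq_zero _ _ (fun h' => h h'.1)).symm

theorem vert_mul_of_ne {u v : S.Q.V} (h : u ≠ v) : S.vert u * S.vert v = 0 := by
  rw [vert, vert, ← map_mul, ← map_zero S.proj]
  congr 1
  ext p
  rw [CPA.vertex_mul_apply]
  split_ifs with h'
  · exact CPA.vertex_eq_zero _ _ (fun h'' => h (h'.symm.trans h''.1))
  · rfl

theorem vert_mul_arr (a : S.Q.A) : S.vert (S.Q.t a) * S.arr a = S.arr a := by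
  rw [vert, arr, ← map_mul]
  congr 1
  ext p
  rw [CPA.vertex_mul_apply]
  split_ifs with h
  · rfl
  · rw [CPA.arrow, CPA.ofPath, if_neg]
    rintro rfl
    exact h rfl

theorem arr_mul_vert (a : S.Q.A) : S.arr a * S.vert (S.Q.s a) = S.arr a := by
  rw [vert, arr, ← map_mul]
  congr 1
  ext p
  rw [CPA.mul_vertex_apply]
  split_ifs with h
  · rfl
  · rw [CPA.arrow, CPA.ofPath, if_neg]
    rintro rfl
    exact h rfl

theorem eta_idem' : IsIdempotentElem (S.eta S.vert) :=
  S.eta_idem S.vert (fun _ _ _ _ h => S.vert_mul_of_ne h) (fun u _ => S.vert_mul_self u)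

/-- The algebra `η(ΛG)η`. -/
abbrev Basic : Type (max u w z) :=
  CornerAlg (SkewMonoidAlgebra S.Jac G) (S.eta S.vert) S.eta_idem'

theorem mem_basic {x : SkewMonoidAlgebra S.Jac G} :
    x ∈ Subsemigroup.corner (S.eta S.vert) ↔ S.eta S.vert * x = x ∧ x * S.eta S.vert = x :=
  Subsemigroup.mem_corner_iff S.eta_idem'

theorem dualHom_eta (ψ : G →* kˣ) : dualHom ψ (S.eta S.vert) = S.eta S.vert := by
  rw [SkewSetting.eta, finsum_mem_eq_finite_toFinset_sum _ (Set.toFinite S.E), _root_.map_sum]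
  refine Finset.sum_congr rfl fun u _ => ?_
  simp [dualHom_single]

/-- The restriction of the action of `Ĝ` to `η(ΛG)η`. -/
instance : MulSemiringAction (G →* kˣ) S.Basic where
  smul ψ x := ⟨dualHom ψ x.1, by
    have hx := S.mem_basic.1 x.2
    refine S.mem_basic.2 ⟨?_, ?_⟩
    · have := congrArg (dualHom ψ) hx.1
      rwa [map_mul, S.dualHom_eta ψ] at this
    · have := congrArg (dualHom ψ) hx.2
      rwa [map_mul, S.dualHom_eta ψ] at this⟩
  one_smul x := Subtype.ext (dualHom_one x.1)
  mul_smul ψ ψ' x := Subtype.ext (dualHom_mul ψ ψ' x.1)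
  smul_zero ψ := Subtype.ext (map_zero (dualHom ψ))
  smul_add ψ x y := Subtype.ext (map_add (dualHom ψ) x.1 y.1)
  smul_one ψ := Subtype.ext (S.dualHom_eta ψ)
  smul_mul ψ x y := Subtype.ext (map_mul (dualHom ψ) x.1 y.1)

instance : SMulCommClass (G →* kˣ) k S.Basic where
  smul_comm ψ c x := Subtype.ext (dualHom_smul ψ c x.1)

end

end SkewQP

end

noncomputable section

open SkewMonoidAlgebra

section charIdem

variable {k : Type*} [Field k] {G : Type*} [Group G] [Finite G] {Λ : Type*} [Ring Λ] [Algebra k Λ]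
  [MulSemiringAction G Λ] [SMulCommClass G k Λ]

theorem charIdem_commute (χ : G →* kˣ) {a : Λ} (ha : ∀ h : G, h • a = a) :
    SkewSetting.charIdem Λ χ * single 1 a = single 1 a * SkewSetting.charIdem Λ χ := by
  have := Fintype.ofFinite G
  rw [SkewSetting.charIdem, finsum_eq_sum_of_fintype, smul_mul_assoc, mul_smul_comm,
    Finset.sum_mul, Finset.mul_sum]
  congr 1
  refine Finset.sum_congr rfl fun h _ => ?_
  rw [smul_mul_assoc, mul_smul_comm, single_mul_single, single_mul_single]
  simp [ha]

theorem charIdem_mul_self (hn : (Nat.card G : k) ≠ 0) (χ : G →* kˣ) :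
    SkewSetting.charIdem Λ χ * SkewSetting.charIdem Λ χ = SkewSetting.charIdem Λ χ := by
  have := Fintype.ofFinite G
  have key : ∀ h : G, (χ h : k) • single h (1 : Λ) * ∑ h' : G, (χ h' : k) • single h' (1 : Λ) =
      ∑ h' : G, (χ h' : k) • single h' (1 : Λ) := by
    intro h
    rw [Finset.mul_sum,
      ← Equiv.sum_comp (Equiv.mulLeft h) (fun h' : G => (χ h' : k) • single h' (1 : Λ))]
    refine Finset.sum_congr rfl fun h' _ => ?_
    rw [smul_mul_smul_comm, single_mul_single]
    simp
  rw [SkewSetting.charIdem, finsum_eq_sum_of_fintype, smul_mul_smul_comm, Finset.sum_mul,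
    Finset.sum_congr rfl (fun h _ => key h), Finset.sum_const, Finset.card_univ,
    ← Nat.card_eq_fintype_card, ← Nat.cast_smul_eq_nsmul k, smul_smul, mul_assoc,
    inv_mul_cancel₀ hn, mul_one]

end charIdem

theorem card_ne_zero_of_roots (k : Type*) [Field k] (G : Type*) [CommGroup G] [Finite G]
    [IsCyclic G] [HasEnoughRootsOfUnity k (Monoid.exponent G)] : (Nat.card G : k) ≠ 0 := by
  obtain ⟨ζ, hζ⟩ := HasEnoughRootsOfUnity.exists_primitiveRoot k (Monoid.exponent G)
  rw [IsCyclic.exponent_eq_card] at hζ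
  have : NeZero (Nat.card G) := ⟨Nat.card_pos.ne'⟩
  exact hζ.neZero'.out

namespace SkewSetting

instance {k : Type z} [Field k] {G : Type w} [Group G] [Finite (G →* kˣ)]
    (D : SkewSetting.{u} k G) [Finite D.Q.V] : Finite D.dual.Q.V := by
  let f : D.Vertex → D.Q.V ⊕ (D.Q.V × (G →* kˣ)) := fun v =>
    match v with
    | .moved ε _ _ => Sum.inl ε
    | .fixed ε _ χ => Sum.inr (ε, χ)
  refine Finite.of_injective f ?_
  intro v v' h
  cases v <;> cases v'
  · cases Sum.inl.inj h; rfl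
  · cases h
  · cases h
  · cases Sum.inr.inj h; rfl

end SkewSetting

namespace SkewQP

variable {k : Type z} [Field k] {G : Type w} [CommGroup G] [Finite G]
  (S : SkewQP.{u} k G)

theorem mem_basic_of {u v : S.Q.V} (hu : u ∈ S.E) (hv : v ∈ S.E) {y : SkewMonoidAlgebra S.Jac G}
    (h1 : single 1 (S.vert u) * y = y) (h2 : y * single 1 (S.vert v) = y) :
    y ∈ Subsemigroup.corner (S.eta S.vert) := by
  have he : ∀ u ∈ S.E, ∀ v ∈ S.E, u ≠ v → S.vert u * S.vert v = 0 :=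
    fun _ _ _ _ h => S.vert_mul_of_ne h
  have he' : ∀ u ∈ S.E, S.vert u * S.vert u = S.vert u := fun u _ => S.vert_mul_self u
  refine S.mem_basic.2 ⟨?_, ?_⟩
  · rw [← h1, ← mul_assoc, S.eta_mul S.vert he he' hu]
  · rw [← h2, mul_assoc, S.mul_eta S.vert he he' hv]

theorem charIdem_vert (χ : G →* kˣ) {v : S.Q.V} (hv : v ∉ S.N) :
    SkewSetting.charIdem S.Jac χ * single 1 (S.vert v) =
      single 1 (S.vert v) * SkewSetting.charIdem S.Jac χ :=
  charIdem_commute χ fun h => by rw [S.smul_vert, S.fixed v hv]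

theorem vertexElt_mem (v : S.Vertex) :
    S.vertexElt S.vert v ∈ Subsemigroup.corner (S.eta S.vert) := by
  cases v with
  | moved ε hE hN =>
    refine S.mem_basic_of hE hE ?_ ?_ <;>
    simp [SkewSetting.vertexElt, single_mul_single, S.vert_mul_self]
  | fixed ε hN χ =>
    refine S.mem_basic_of (S.mem_E_of_fixed hN) (S.mem_E_of_fixed hN) ?_ ?_
    · simp only [SkewSetting.vertexElt]
      rw [← mul_assoc, single_mul_single]
      simp [S.vert_mul_self]
    · simp only [SkewSetting.vertexElt]
      rw [mul_assoc, S.charIdem_vert χ hN, ← mul_assoc, single_mul_single]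
      simp [S.vert_mul_self]

theorem arrowElt_mem (a : S.Arrow) :
    S.arrowElt S.arr a ∈ Subsemigroup.corner (S.eta S.vert) := by
  cases a with
  | one α hs ht hE =>
    refine S.mem_basic_of hE (S.rep_mem_E (S.Q.s α)) ?_ ?_
    · simp [SkewSetting.arrowElt, single_mul_single, S.vert_mul_arr]
    · simp only [SkewSetting.arrowElt]
      rw [single_mul_single, S.smul_vert, S.onV_pos, S.arr_mul_vert, mul_one]
  | two α hs ht hE χ =>
    refine S.mem_basic_of (S.mem_E_of_fixed ht) hE ?_ ?_
    · simp only [SkewSetting.arrowElt]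
      rw [← mul_assoc, ← S.charIdem_vert χ ht, mul_assoc, single_mul_single]
      simp [S.vert_mul_arr]
    · simp only [SkewSetting.arrowElt]
      rw [mul_assoc, single_mul_single]
      simp [S.arr_mul_vert]
  | three α hs ht hE χ =>
    refine S.mem_basic_of hE (S.mem_E_of_fixed hs) ?_ ?_
    · simp only [SkewSetting.arrowElt]
      rw [← mul_assoc, single_mul_single]
      simp [S.vert_mul_arr]
    · simp only [SkewSetting.arrowElt]
      rw [mul_assoc, S.charIdem_vert χ hs, ← mul_assoc, single_mul_single]
      simp [S.arr_mul_vert]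
  | four α hs ht χ =>
    refine S.mem_basic_of (S.mem_E_of_fixed ht) (S.mem_E_of_fixed hs) ?_ ?_
    · simp only [SkewSetting.arrowElt]
      rw [← mul_assoc, single_mul_single]
      simp [S.vert_mul_arr]
    · simp only [SkewSetting.arrowElt]
      rw [mul_assoc, S.charIdem_vert χ hs, ← mul_assoc, single_mul_single]
      simp [S.arr_mul_vert]

/-- The vertices of `Q_G`, as idempotents of `η(ΛG)η`. -/
def basicVert (v : S.dual.Q.V) : S.Basic := ⟨S.vertexElt S.vert v, S.vertexElt_mem v⟩

/-- The arrows of `Q_G`, as elements of `η(ΛG)η`. -/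
def basicArr (a : S.dual.Q.A) : S.Basic := ⟨S.arrowElt S.arr a, S.arrowElt_mem a⟩

theorem basicVert_mul_of_ne {u v : S.dual.Q.V} (hu : u ∈ S.dual.E) (hv : v ∈ S.dual.E)
    (h : u ≠ v) : S.basicVert u * S.basicVert v = 0 := by
  refine Subtype.ext ?_
  change S.vertexElt S.vert u * S.vertexElt S.vert v = 0
  have h0 : ∀ {a b : S.Q.V}, a ≠ b →
      (single 1 (S.vert a) * single 1 (S.vert b) : SkewMonoidAlgebra S.Jac G) = 0 := by
    intro a b hab
    simp [single_mul_single, S.vert_mul_of_ne hab]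
  rcases hu with ⟨a, ha, ha', rfl⟩ | ⟨a, ha, rfl⟩ <;>
    rcases hv with ⟨b, hb, hb', rfl⟩ | ⟨b, hb, rfl⟩
  · exact h0 (by rintro rfl; exact h rfl)
  · simp only [SkewSetting.vertexElt]
    rw [← mul_assoc, h0 (by rintro rfl; exact hb ha'), zero_mul]
  · simp only [SkewSetting.vertexElt]
    rw [← S.charIdem_vert 1 ha, mul_assoc, h0 (by rintro rfl; exact ha hb'), mul_zero]
  · simp only [SkewSetting.vertexElt]
    rw [← S.charIdem_vert 1 ha, mul_assoc, ← mul_assoc (single 1 (S.vert a)),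
      h0 (by rintro rfl; exact h rfl), zero_mul, mul_zero]

theorem basicVert_mul_self (hn : (Nat.card G : k) ≠ 0) {u : S.dual.Q.V} :
    S.basicVert u * S.basicVert u = S.basicVert u := by
  refine Subtype.ext ?_
  change S.vertexElt S.vert u * S.vertexElt S.vert u = S.vertexElt S.vert u
  cases u with
  | moved => simp [SkewSetting.vertexElt, single_mul_single, S.vert_mul_self]
  | fixed ε hN χ =>
    simp only [SkewSetting.vertexElt]
    rw [mul_assoc, ← mul_assoc (SkewSetting.charIdem S.Jac χ), S.charIdem_vert χ hN,
      mul_assoc, charIdem_mul_self hn, ← mul_assoc, single_mul_single]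
    simp [S.vert_mul_self]

section roots

variable [IsCyclic G] [HasEnoughRootsOfUnity k (Monoid.exponent G)]

/-- `θ = ∑_{s ∈ E_G} s ⊗ 1` in `(η(ΛG)η)Ĝ`. -/
def theta : SkewMonoidAlgebra S.Basic (G →* kˣ) := S.dual.eta S.basicVert

theorem theta_idem : IsIdempotentElem S.theta :=
  S.dual.eta_idem S.basicVert (fun _ hu _ hv h => S.basicVert_mul_of_ne hu hv h)
    (fun _ _ => S.basicVert_mul_self (card_ne_zero_of_roots k G))

/-- The algebra `θ((η(ΛG)η)Ĝ)θ`. -/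
abbrev DoubleBasic : Type (max u w z) :=
  CornerAlg (SkewMonoidAlgebra S.Basic (G →* kˣ)) S.theta S.theta_idem

end roots

end SkewQP

namespace SkewSetting

variable {k : Type z} [Field k] {G : Type w} [CommGroup G] [Finite G]
  [HasEnoughRootsOfUnity k (Monoid.exponent G)] (D : SkewSetting.{u} k G)

/-- The map `φ : (Q_G)_Ĝ → Q` on vertices: `η^ε_1 ⊗ 1 ↦ ε` and `η^ε ⊗ e_ω ↦ h(ε)`, where the
character `ω` of `Ĝ` is the evaluation at `h ∈ G`. (The other two cases do not occur.) -/
def phiV : D.dual.Vertex → D.Q.V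
  | .moved v _ hN =>
    match v, hN with
    | .fixed ε _ _, _ => ε
    | .moved ε _ _, _ => ε
  | .fixed v hN ω =>
    match v, hN with
    | .moved ε _ _, _ => D.σ.onV (CommGroup.monoidHomMonoidHomEquiv G k ω) ε
    | .fixed ε _ _, _ => ε

end SkewSetting

end

noncomputable section

namespace SkewSetting

variable {k : Type z} [Field k] {G : Type w} [CommGroup G] [Finite G]
  [HasEnoughRootsOfUnity k (Monoid.exponent G)] (D : SkewSetting.{u} k G)

/-- The map `φ : (Q_G)_Ĝ → Q` on arrows. For `ω` the evaluation at `h`, it maps the arrow given by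
`α̃^{b(α)}`, `α` of type (4), to `α`; the arrows given by `α̃^1` and `ω`, `α` of type (2) or (3), to
`h(α)`; the arrow given by `α̃` and `ω`, `α` of type (1), to `h t(α)⁻¹ (α)`, where
`t(α) = pos (s α)`. (The other cases do not occur.) -/
def phiA : D.dual.Arrow → D.Q.A
  | .one a _ _ _ =>
    match a with
    | .one α _ _ _ => α
    | .two α _ _ _ _ => α
    | .three α _ _ _ _ => α
    | .four α _ _ _ => α
  | .two a _ _ _ ω | .three a _ _ _ ω =>
    match a with
    | .one α _ _ _ => α
    | .two α _ _ _ _ => D.σ.onA (CommGroup.monoidHomMonoidHomEquiv G k ω) α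
    | .three α _ _ _ _ => D.σ.onA (CommGroup.monoidHomMonoidHomEquiv G k ω) α
    | .four α _ _ _ => α
  | .four a _ _ ω =>
    match a with
    | .one α _ _ _ =>
      D.σ.onA (CommGroup.monoidHomMonoidHomEquiv G k ω * (D.pos (D.Q.s α))⁻¹) α
    | .two α _ _ _ _ => α
    | .three α _ _ _ _ => α
    | .four α _ _ _ => α

/-- The normalization of the arrows `γ` of `(Q_G)_Ĝ`: the scalar is `|G|` for the arrows of
type (3), and `1` for the arrows of the other types. -/
def scale : D.dual.Arrow → k
  | .three _ _ _ _ _ => Nat.card G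
  | _ => 1

end SkewSetting

end

/-!
Up to the choice of idempotents, the theorem is the duality between the actions of `G` and `Ĝ` on the
iterated skew group algebra `B = (ΛG)Ĝ`, for the action of `G` on `Λ` which permutes the idempotents
of the vertices.

For `h ∈ G` let `f_h = |G|⁻¹ ∑_ψ ψ(h) ψ`, an idempotent of `kĜ`. These idempotents are orthogonal with
sum `1`, they commute with `Λ`, and `f_x g = g f_{xg}` (`dualIdem_grp`). Hence `f₁ B f₁ = Λ f₁`, and
`a ↦ a f₁` identifies `Λ` with this corner (`exists_coef_mul_dualIdem`,
`coef_mul_dualIdem_injective`). It remains to compare the idempotents `f₁` and `θ`. If `v = h(ε)` is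
a vertex which is not fixed, with `ε ∈ E`, then `v f₁` and `ε f_h` are equivalent through
`v f₁ h = h ε f_h`. If `v` is fixed, then `v f₁` and `v e₁`, where `e₁ = |G|⁻¹ ∑_g g`, are equivalent
since `f₁ e₁ f₁ = |G|⁻¹ f₁` and `e₁ f₁ e₁ = |G|⁻¹ e₁`. Summing these elements over all vertices gives
`u, u' ∈ B` with `u u' = f₁` (`totalLink_mul_totalColink`) and `u' u = θ` (`incl_theta`), so
`a ↦ u' a u` is an isomorphism `Λ ≅ θBθ`. Finally `(η(ΛG)η)Ĝ` is the corner of `B` at `η`, which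
contains `θBθ`, so `θBθ` is the algebra of the theorem (`exists_incl_eq`,
`exists_equiv_cornerAlg`). The images of the vertices and arrows are computed from
`conj_eq`; the factor `|G|` in `colink` is responsible for the normalization of the arrows of
type (3).

The group `Ĝ` and the ring `ΛG` are used through the types `Dual` and `SkewAlg`, which carry a single
sealed instance each.
-/

noncomputable section

/-! ### Duality for iterated skew group algebras -/

namespace SkewDuality

open SkewMonoidAlgebra

/-- The dual group `Ĝ = Hom(G, kˣ)`, as a type of its own, with its group structure sealed in one
instance. -/
def Dual (k : Type*) [Field k] (G : Type*) [CommGroup G] : Type _ := G →* kˣ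

namespace Dual

variable {k : Type*} [Field k] {G : Type*} [CommGroup G]

instance : CommGroup (Dual k G) := inferInstanceAs (CommGroup (G →* kˣ))
instance : FunLike (Dual k G) G kˣ := inferInstanceAs (FunLike (G →* kˣ) G kˣ)
instance : MonoidHomClass (Dual k G) G kˣ := inferInstanceAs (MonoidHomClass (G →* kˣ) G kˣ)

@[simp] theorem mul_apply (ψ ψ' : Dual k G) (x : G) : (ψ * ψ') x = ψ x * ψ' x := rfl
@[simp] theorem one_apply (x : G) : (1 : Dual k G) x = 1 := rfl

/-- The identity map from the group of characters. -/
def mk : (G →* kˣ) ≃* Dual k G := MulEquiv.refl _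

@[simp] theorem mk_apply (ψ : G →* kˣ) (x : G) : mk ψ x = ψ x := rfl

end Dual

section characters

variable (k : Type*) [Field k] {G : Type*} [CommGroup G] [Fintype G]
  [HasEnoughRootsOfUnity k (Monoid.exponent G)]

theorem sum_apply_char_of_ne {ψ : Dual k G} (hψ : ψ ≠ 1) : ∑ x : G, (ψ x : k) = 0 := by
  let f : G →* k :=
    { toFun := fun x => (ψ x : k)
      map_one' := by simp
      map_mul' := fun x y => by simp }
  refine sum_hom_units_eq_zero f fun h => hψ (DFunLike.ext _ _ fun x => Units.ext ?_)
  exact DFunLike.congr_fun h x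

theorem card_dual : Nat.card (Dual k G) = Nat.card G :=
  CommGroup.card_monoidHom_of_hasEnoughRootsOfUnity G k

theorem sum_char_apply_of_ne [Fintype (Dual k G)] {x : G} (hx : x ≠ 1) :
    ∑ ψ : Dual k G, (ψ x : k) = 0 := by
  let f : Dual k G →* k :=
    { toFun := fun ψ => (ψ x : k)
      map_one' := by simp
      map_mul' := fun ψ ψ' => by simp }
  refine sum_hom_units_eq_zero f fun h => hx ?_
  refine (CommGroup.forall_apply_eq_apply_iff G (M := k)).1 ?_
  intro ψ
  have h' : (ψ x : k) = 1 := DFunLike.congr_fun h (Dual.mk ψ)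
  simpa using h'

theorem sum_char_apply_one [Fintype (Dual k G)] :
    ∑ ψ : Dual k G, (ψ (1 : G) : k) = Nat.card G := by
  simp only [map_one, Units.val_one, Finset.sum_const, Finset.card_univ, nsmul_eq_mul, mul_one]
  rw [← Nat.card_eq_fintype_card, card_dual]

end characters

section general

variable (k : Type*) [Field k] (G : Type*) [CommGroup G] (Λ : Type*) [Ring Λ] [Algebra k Λ]
  [MulSemiringAction G Λ] [SMulCommClass G k Λ]

/-- The skew group algebra `ΛG`, as a type of its own: it serves as the ring of coefficients of the
iterated skew group algebra, and its ring structure is sealed in one instance. -/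
def SkewAlg : Type _ := SkewMonoidAlgebra Λ G

instance : Ring (SkewAlg G Λ) := inferInstanceAs (Ring (SkewMonoidAlgebra Λ G))

instance : Algebra k (SkewAlg G Λ) := inferInstanceAs (Algebra k (SkewMonoidAlgebra Λ G))

variable {k G Λ}

variable (k) in
/-- The identity map from the skew group algebra. -/
def SkewAlg.mk : SkewMonoidAlgebra Λ G ≃ₐ[k] SkewAlg G Λ := AlgEquiv.refl

/-- The element `a ⊗ g` of `ΛG`. -/
def elt (g : G) (a : Λ) : SkewAlg G Λ := single g a

theorem mk_single (g : G) (a : Λ) : SkewAlg.mk k (single g a) = elt g a := rfl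

theorem elt_mul_elt (g h : G) (a b : Λ) : elt g a * elt h b = elt (g * h) (a * g • b) :=
  single_mul_single

theorem smul_elt (c : k) (g : G) (a : Λ) : c • elt g a = elt g (c • a) := smul_single c g a

/-- The dual group acts on the skew group algebra by `ψ(λ ⊗ g) = ψ(g) λ ⊗ g`. -/
instance : MulSemiringAction (Dual k G) (SkewAlg G Λ) where
  smul ψ x := dualHom (k := k) ψ x
  one_smul x := dualHom_one x
  mul_smul ψ ψ' x := dualHom_mul ψ ψ' x
  smul_zero ψ := map_zero (dualHom (k := k) ψ)
  smul_add ψ x y := map_add (dualHom (k := k) ψ) x y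
  smul_one ψ := map_one (dualHom (k := k) ψ)
  smul_mul ψ x y := map_mul (dualHom (k := k) ψ) x y

theorem char_smul_elt (ψ : Dual k G) (g : G) (a : Λ) :
    ψ • elt g a = elt g ((ψ g : k) • a) := dualHom_single ψ g a

instance : SMulCommClass (Dual k G) k (SkewAlg G Λ) where
  smul_comm ψ c x := dualHom_smul ψ c x

variable (k G Λ)

/-- The iterated skew group algebra `(ΛG)Ĝ`. -/
abbrev DoubleSkew := SkewMonoidAlgebra (SkewAlg G Λ) (Dual k G)

variable {Λ}

/-- The embedding of the coefficients `Λ` into `(ΛG)Ĝ`. -/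
def coef : Λ →+* DoubleSkew k G Λ :=
  singleOneRingHom.comp (singleOneRingHom : Λ →+* SkewMonoidAlgebra Λ G)

variable {G} (Λ)

/-- The embedding of `G` into `(ΛG)Ĝ`. -/
def grp : G →* DoubleSkew k G Λ :=
  (singleOneRingHom : SkewAlg G Λ →+* DoubleSkew k G Λ).toMonoidHom.comp (of Λ G)

variable {k}

/-- The embedding of `Ĝ` into `(ΛG)Ĝ`. -/
def chr : (Dual k G) →* DoubleSkew k G Λ := of (SkewAlg G Λ) (Dual k G)

variable (k G) {Λ}

theorem coef_apply (a : Λ) : coef k G a = single 1 (elt 1 a) := rfl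
theorem grp_apply (g : G) : grp k Λ g = single 1 (elt g 1) := rfl
theorem chr_apply (ψ : Dual k G) : chr Λ ψ = single ψ 1 := rfl

variable {k G}

theorem single_single (ψ : Dual k G) (g : G) (a : Λ) :
    (single ψ (elt g a) : DoubleSkew k G Λ) = coef k G a * grp k Λ g * chr Λ ψ := by
  simp [coef_apply, grp_apply, chr_apply, single_mul_single, elt_mul_elt]

theorem coef_smul (c : k) (a : Λ) : coef k G (c • a) = c • coef k G a := by
  simp [coef_apply, smul_single, smul_elt]

theorem grp_coef (g : G) (a : Λ) : grp k Λ g * coef k G a = coef k G (g • a) * grp k Λ g := by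
  simp [coef_apply, grp_apply, single_mul_single, elt_mul_elt]

theorem chr_coef (ψ : Dual k G) (a : Λ) : chr Λ ψ * coef k G a = coef k G a * chr Λ ψ := by
  simp [coef_apply, chr_apply, single_mul_single, char_smul_elt]

theorem chr_grp (ψ : Dual k G) (g : G) :
    chr Λ ψ * grp k Λ g = (ψ g : k) • (grp k Λ g * chr Λ ψ) := by
  simp [grp_apply, chr_apply, single_mul_single, char_smul_elt, smul_single, smul_elt]

variable (k Λ)

/-- The idempotent `f_x = |G|⁻¹ ∑_ψ ψ(x) ψ` of `kĜ`, viewed in `(ΛG)Ĝ`; it belongs to the character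
"evaluation at `x`" of `Ĝ`. -/
def dualIdem [Fintype (Dual k G)] (x : G) : DoubleSkew k G Λ :=
  (Nat.card G : k)⁻¹ • ∑ ψ : Dual k G, (ψ x : k) • chr Λ ψ

variable {k}

/-- The idempotent `e_χ = |G|⁻¹ ∑_g χ(g) g` of `kG`, viewed in `(ΛG)Ĝ`. -/
def grpIdem [Fintype G] (χ : Dual k G) : DoubleSkew k G Λ :=
  (Nat.card G : k)⁻¹ • ∑ g : G, (χ g : k) • grp k Λ g

variable {Λ}

theorem grpIdem_eq [Fintype G] (χ : G →* kˣ) :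
    grpIdem Λ (Dual.mk χ) = single 1 (SkewAlg.mk k (SkewSetting.charIdem Λ χ)) := by
  rw [SkewSetting.charIdem, finsum_eq_sum_of_fintype, map_smul, _root_.map_sum, grpIdem,
    ← smul_single]
  congr 1
  refine (Finset.sum_congr rfl fun g _ => ?_).trans
    (_root_.map_sum (singleAddHom (1 : Dual k G)) _ _).symm
  rw [map_smul, mk_single]
  exact smul_single _ _ _

section

variable [Fintype (Dual k G)]

theorem dualIdem_coef (x : G) (a : Λ) :
    dualIdem k Λ x * coef k G a = coef k G a * dualIdem k Λ x := by
  simp [dualIdem, Finset.sum_mul, Finset.mul_sum, chr_coef]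

theorem dualIdem_grp (x g : G) :
    dualIdem k Λ x * grp k Λ g = grp k Λ g * dualIdem k Λ (x * g) := by
  simp [dualIdem, Finset.sum_mul, Finset.mul_sum, chr_grp, smul_smul]

theorem chr_dualIdem (ψ : Dual k G) (x : G) :
    chr Λ ψ * dualIdem k Λ x = (ψ x⁻¹ : k) • dualIdem k Λ x := by
  rw [dualIdem, mul_smul_comm, Finset.mul_sum, smul_comm, Finset.smul_sum (r := (ψ x⁻¹ : k)),
    ← Equiv.sum_comp (Equiv.mulLeft ψ) (fun ψ' => (ψ x⁻¹ : k) • (ψ' x : k) • chr Λ ψ')]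
  congr 1
  refine Finset.sum_congr rfl fun ψ' _ => ?_
  simp [smul_smul]

variable [Fintype G]

theorem grpIdem_coef {χ b : Dual k G} {a : Λ} (ha : ∀ g : G, g • a = (b g : k) • a) :
    grpIdem Λ χ * coef k G a = coef k G a * grpIdem Λ (χ * b) := by
  simp [grpIdem, Finset.sum_mul, Finset.mul_sum, grp_coef, ha, coef_smul, smul_smul]

theorem grpIdem_chr (χ ψ : Dual k G) :
    grpIdem Λ (χ * ψ) * chr Λ ψ = chr Λ ψ * grpIdem Λ χ := by
  simp [grpIdem, Finset.sum_mul, Finset.mul_sum, chr_grp, smul_smul]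

theorem grp_grpIdem_one (g : G) : grp k Λ g * grpIdem Λ 1 = grpIdem Λ (1 : Dual k G) := by
  rw [grpIdem, mul_smul_comm, Finset.mul_sum,
    ← Equiv.sum_comp (Equiv.mulLeft g) (fun x : G => ((1 : Dual k G) x : k) • grp k Λ x)]
  simp

theorem grpIdem_one_grp (g : G) : grpIdem Λ 1 * grp k Λ g = grpIdem Λ (1 : Dual k G) := by
  rw [grpIdem, smul_mul_assoc, Finset.sum_mul,
    ← Equiv.sum_comp (Equiv.mulRight g) (fun x : G => ((1 : Dual k G) x : k) • grp k Λ x)]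
  simp

theorem dualIdem_mul (x : G) (y : DoubleSkew k G Λ) :
    dualIdem k Λ x * y = (Nat.card G : k)⁻¹ • ∑ ψ : Dual k G, (ψ x : k) • (chr Λ ψ * y) := by
  simp only [dualIdem, smul_mul_assoc, Finset.sum_mul]

/-- Conjugation of `f₁ a` with `h` gives `h⁻¹(a) f_h`. -/
theorem grp_inv_dualIdem_coef (h : G) (a : Λ) :
    grp k Λ h⁻¹ * dualIdem k Λ 1 * coef k G (h • a) =
      coef k G a * dualIdem k Λ h * grp k Λ h⁻¹ := by
  rw [mul_assoc, dualIdem_coef, ← mul_assoc, grp_coef, inv_smul_smul, mul_assoc, mul_assoc,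
    dualIdem_grp, mul_inv_cancel]

variable [HasEnoughRootsOfUnity k (Monoid.exponent G)]

theorem dualIdem_mul_dualIdem_of_ne {x y : G} (h : x ≠ y) :
    dualIdem k Λ x * dualIdem k Λ y = 0 := by
  have := sum_char_apply_of_ne k fun e => h (mul_inv_eq_one.1 e)
  rw [dualIdem_mul]
  simp_rw [chr_dualIdem, smul_smul, ← Units.val_mul, ← map_mul, ← Finset.sum_smul,
    this, zero_smul, smul_zero]

variable [IsCyclic G]

theorem dualIdem_mul_self (x : G) : dualIdem k Λ x * dualIdem k Λ x = dualIdem k Λ x := by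
  have := sum_char_apply_one k (G := G)
  rw [← mul_inv_cancel x] at this
  rw [dualIdem_mul]
  simp_rw [chr_dualIdem, smul_smul, ← Units.val_mul, ← map_mul, ← Finset.sum_smul, this,
    smul_smul, inv_mul_cancel₀ (card_ne_zero_of_roots k G), one_smul]

theorem grpIdem_one_mul_self : grpIdem Λ 1 * grpIdem Λ (1 : Dual k G) = grpIdem Λ 1 := by
  have h : ∀ y : DoubleSkew k G Λ,
      grpIdem Λ 1 * y = (Nat.card G : k)⁻¹ • ∑ g : G, grp k Λ g * y := fun y => by
    simp [grpIdem, Finset.sum_mul]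
  rw [h]
  simp [grp_grpIdem_one, ← Nat.card_eq_fintype_card, ← Nat.cast_smul_eq_nsmul k, smul_smul,
    card_ne_zero_of_roots k G]

theorem sum_dualIdem : ∑ x : G, dualIdem k Λ x = 1 := by
  simp_rw [dualIdem]
  rw [← Finset.smul_sum, Finset.sum_comm]
  simp_rw [← Finset.sum_smul]
  rw [Finset.sum_eq_single 1 (fun ψ _ h => by rw [sum_apply_char_of_ne k h, zero_smul]) (by simp)]
  simp [smul_smul, ← Nat.card_eq_fintype_card, card_ne_zero_of_roots k G]

theorem dualIdem_grp_dualIdem (g : G) (hg : g ≠ 1) :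
    dualIdem k Λ 1 * grp k Λ g * dualIdem k Λ 1 = 0 := by
  rw [dualIdem_grp, mul_assoc, dualIdem_mul_dualIdem_of_ne (by simpa using hg), mul_zero]

theorem dualIdem_grpIdem_dualIdem :
    dualIdem k Λ (1 : G) * grpIdem Λ 1 * dualIdem k Λ 1 = (Nat.card G : k)⁻¹ • dualIdem k Λ 1 := by
  rw [grpIdem, mul_smul_comm, smul_mul_assoc, Finset.mul_sum, Finset.sum_mul,
    Finset.sum_eq_single 1]
  · simp [dualIdem_mul_self]
  · intro g _ hg
    simp [dualIdem_grp_dualIdem g hg]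
  · simp

theorem grpIdem_dualIdem_grpIdem :
    grpIdem Λ 1 * dualIdem k Λ (1 : G) * grpIdem Λ 1 = (Nat.card G : k)⁻¹ • grpIdem Λ 1 := by
  have h : ∀ g : G, grpIdem Λ 1 * dualIdem k Λ (1 : G) * grp k Λ g =
      grpIdem Λ 1 * dualIdem k Λ g := fun g => by
    rw [mul_assoc, dualIdem_grp, ← mul_assoc, grpIdem_one_grp, one_mul]
  have h' : ∀ y : DoubleSkew k G Λ,
      y * grpIdem Λ 1 = (Nat.card G : k)⁻¹ • ∑ g : G, y * grp k Λ g := fun y => by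
    simp [grpIdem, Finset.mul_sum]
  rw [h', Finset.sum_congr rfl fun g _ => h g, ← Finset.mul_sum, sum_dualIdem, mul_one]

theorem grpIdem_dualIdem_grpIdem_one (b : Dual k G) :
    grpIdem Λ b * dualIdem k Λ (1 : G) * grpIdem Λ 1 =
      (Nat.card G : k)⁻¹ • (grpIdem Λ b * chr Λ b) := by
  have h : grpIdem Λ b = chr Λ b * grpIdem Λ 1 * chr Λ b⁻¹ := by
    rw [← grpIdem_chr, one_mul, mul_assoc, ← map_mul, mul_inv_cancel, map_one, mul_one]
  have h' : chr Λ b⁻¹ * dualIdem k Λ (1 : G) = dualIdem k Λ 1 := by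
    rw [chr_dualIdem, inv_one, map_one, Units.val_one, one_smul]
  conv_lhs => rw [h, mul_assoc _ (chr Λ b⁻¹), h', mul_assoc, mul_assoc, ← mul_assoc (grpIdem Λ 1),
    grpIdem_dualIdem_grpIdem, mul_smul_comm, ← grpIdem_chr, one_mul]

/-- `f₁ (ΛG)Ĝ f₁ = Λ f₁`: the product `f₁ g f₁` vanishes for `g ≠ 1`, and `Ĝ` acts trivially on
`f₁`. -/
theorem exists_coef_mul_dualIdem (y : DoubleSkew k G Λ) :
    ∃ a : Λ, dualIdem k Λ 1 * y * dualIdem k Λ 1 = coef k G a * dualIdem k Λ 1 := by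
  induction y using SkewMonoidAlgebra.induction_on with
  | zero => exact ⟨0, by simp⟩
  | add y z hy hz =>
    obtain ⟨a, ha⟩ := hy
    obtain ⟨b, hb⟩ := hz
    exact ⟨a + b, by rw [mul_add, add_mul, ha, hb, map_add, add_mul]⟩
  | single ψ y =>
    obtain ⟨y, rfl⟩ := (SkewAlg.mk k).surjective y
    induction y using SkewMonoidAlgebra.induction_on with
    | zero => exact ⟨0, by simp⟩
    | add y z hy hz =>
      obtain ⟨a, ha⟩ := hy
      obtain ⟨b, hb⟩ := hz
      exact ⟨a + b, by rw [map_add, single_add, mul_add, add_mul, ha, hb, map_add, add_mul]⟩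
    | single g a =>
      have h : dualIdem k Λ 1 * single ψ (SkewAlg.mk k (single g a)) * dualIdem k Λ 1 =
          coef k G a * (dualIdem k Λ 1 * grp k Λ g * dualIdem k Λ 1) := by
        rw [mk_single, single_single, mul_assoc, mul_assoc (coef k G a * _), chr_dualIdem,
          inv_one, map_one, Units.val_one, one_smul, mul_assoc (coef k G a), ← mul_assoc,
          dualIdem_coef, mul_assoc, mul_assoc]
      rw [h]
      by_cases hg : g = 1
      · exact ⟨a, by rw [hg, map_one, mul_one, dualIdem_mul_self]⟩
      · exact ⟨0, by rw [dualIdem_grp_dualIdem g hg, mul_zero, map_zero, zero_mul]⟩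

theorem coef_mul_dualIdem_injective {a b : Λ}
    (h : coef k G a * dualIdem k Λ (1 : G) = coef k G b * dualIdem k Λ (1 : G)) : a = b := by
  let c : DoubleSkew k G Λ →+ SkewAlg G Λ :=
    (Finsupp.applyAddHom 1).comp coeffAddEquiv.toAddMonoidHom
  have hc : ∀ (ψ : Dual k G) (y : SkewAlg G Λ), c (single ψ y) = Finsupp.single ψ y 1 :=
    fun ψ y => rfl
  have key : ∀ a : Λ, c (coef k G a * dualIdem k Λ (1 : G)) =
      elt 1 ((Nat.card G : k)⁻¹ • a) := fun a => by
    rw [dualIdem, mul_smul_comm, Finset.mul_sum, Finset.smul_sum, _root_.map_sum,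
      Finset.sum_eq_single 1]
    · simp [coef_apply, smul_single, hc, smul_elt]
    · intro ψ _ hψ
      simp [coef_apply, chr_apply, single_mul_single, smul_single, hc, hψ]
    · simp
  have h1 := congrArg c h
  rw [key, key] at h1
  have h2 := single_injective (1 : G) h1
  have hn := card_ne_zero_of_roots k G
  simpa [smul_smul, ← Nat.card_eq_fintype_card, hn] using congrArg ((Nat.card G : k) • ·) h2

end

end general

section corner

variable {k : Type*} [Field k] {A B B' : Type*} [Ring A] [Algebra k A] [Ring B] [Algebra k B]
  [Ring B'] [Algebra k B']

/-- Two non-unital maps `Φ : A → B` and `ι : B' → B` which are injective and such that `Φ` is onto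
`ι(θB'θ)` identify `A` with the corner `θB'θ`. -/
theorem exists_equiv_cornerAlg {θ : B'} (hθ : IsIdempotentElem θ) (ι : B' →ₙₐ[k] B)
    (hι : Function.Injective ι) (Φ : A →ₙₐ[k] B) (hΦ : Function.Injective Φ) (h1 : Φ 1 = ι θ)
    (hmem : ∀ a, ∃ x, ι x = Φ a) (hsurj : ∀ x, θ * x = x → x * θ = x → ∃ a, Φ a = ι x) :
    ∃ Ψ : CornerAlg B' θ hθ ≃ₐ[k] A, ∀ a x, ι x = Φ a → (Ψ.symm a).val = x := by
  choose f hf using hmem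
  have hf1 : ∀ a, θ * f a = f a := fun a => hι (by rw [map_mul, hf, ← h1, ← map_mul, one_mul])
  have hf2 : ∀ a, f a * θ = f a := fun a => hι (by rw [map_mul, hf, ← h1, ← map_mul, mul_one])
  let F : A →ₐ[k] CornerAlg B' θ hθ :=
    AlgHom.ofLinearMap
      { toFun := fun a => ⟨f a, (CornerAlg.mem_iff hθ).2 ⟨hf1 a, hf2 a⟩⟩
        map_add' := fun a b => Subtype.ext (hι (by
          change ι (f (a + b)) = ι (f a + f b)
          rw [map_add, hf, hf, hf, map_add]))
        map_smul' := fun c a => Subtype.ext (hι (by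
          change ι (f (c • a)) = ι (c • f a)
          rw [map_smul, hf, hf, map_smul])) }
      (Subtype.ext (hι ((hf 1).trans h1)))
      (fun a b => Subtype.ext (hι (by
        change ι (f (a * b)) = ι (f a * f b)
        rw [map_mul, hf, hf, hf, map_mul])))
  have hF : ∀ a, (F a).val = f a := fun _ => rfl
  have hbij : Function.Bijective F := by
    refine ⟨fun a b h => hΦ ?_, fun x => ?_⟩
    · rw [← hf, ← hf, ← hF, ← hF, h]
    · have hx := (CornerAlg.mem_iff hθ).1 x.2
      obtain ⟨a, ha⟩ := hsurj x.val hx.1 hx.2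
      exact ⟨a, Subtype.ext (hι ((hf a).trans ha))⟩
  refine ⟨(AlgEquiv.ofBijective F hbij).symm, fun a x hx => hι ?_⟩
  exact (hf a).trans hx.symm

end corner

section mapCoeff

variable {k : Type*} [Field k] {H H' : Type*} [Group H] [Group H'] {R R' : Type*} [Ring R]
  [Algebra k R] [MulSemiringAction H R] [SMulCommClass H k R] [Ring R'] [Algebra k R']
  [MulSemiringAction H' R'] [SMulCommClass H' k R']

/-- The map of skew group algebras induced by an isomorphism of groups and an equivariant
(non-unital) map of coefficients. -/
def mapCoeff (e : H ≃* H') (f : R →ₙₐ[k] R') (hf : ∀ h r, f (h • r) = e h • f r) :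
    SkewMonoidAlgebra R H →ₙₐ[k] SkewMonoidAlgebra R' H' :=
  let F : SkewMonoidAlgebra R H →+ SkewMonoidAlgebra R' H' :=
    coeffAddEquiv.symm.toAddMonoidHom.comp
      ((Finsupp.liftAddHom fun h => (Finsupp.singleAddHom (e h)).comp
        (f : R →+ R')).comp coeffAddEquiv.toAddMonoidHom)
  have hF : ∀ h r, F (single h r) = single (e h) (f r) := fun h r => by
    simp [F]
  { F with
    map_smul' := fun c x => by
      change F (c • x) = c • F x
      induction x using SkewMonoidAlgebra.induction_on with
      | zero => simp
      | add x y hx hy => rw [smul_add, map_add, map_add, hx, hy, smul_add]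
      | single h r => rw [smul_single, hF, hF, map_smul, smul_single]
    map_mul' := fun x y => by
      change F (x * y) = F x * F y
      induction x using SkewMonoidAlgebra.induction_on with
      | zero => simp
      | add x z hx hz => rw [add_mul, map_add, map_add, hx, hz, add_mul]
      | single h r =>
        induction y using SkewMonoidAlgebra.induction_on with
        | zero => simp
        | add y z hy hz => rw [mul_add, map_add, map_add, hy, hz, mul_add]
        | single h' r' =>
          rw [single_mul_single, hF, hF, hF, single_mul_single, map_mul, map_mul, hf] }

variable (e : H ≃* H') (f : R →ₙₐ[k] R') (hf : ∀ h r, f (h • r) = e h • f r)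

theorem mapCoeff_single (h : H) (r : R) : mapCoeff e f hf (single h r) = single (e h) (f r) := by
  simp [mapCoeff]

theorem coeff_mapCoeff (x : SkewMonoidAlgebra R H) (h : H) :
    (mapCoeff e f hf x).coeff (e h) = f (x.coeff h) := by
  induction x using SkewMonoidAlgebra.induction_on with
  | zero => simp
  | add x y hx hy => simp [hx, hy]
  | single h' r =>
    classical
    rw [mapCoeff_single, coeff_single_apply, coeff_single_apply]
    simp [apply_ite f]

theorem mapCoeff_injective (hi : Function.Injective f) : Function.Injective (mapCoeff e f hf) :=
  fun x y h => SkewMonoidAlgebra.ext fun a => hi (by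
    rw [← coeff_mapCoeff e f hf, ← coeff_mapCoeff e f hf, h])

end mapCoeff

end SkewDuality

/-! ### The quiver isomorphism -/

namespace SkewSetting

section general

variable {k : Type z} [Field k] {G : Type w} [Group G] (D : SkewSetting.{u} k G)

theorem rep_onV {ε : D.Q.V} (hε : ε ∈ D.E) (h : G) : D.rep (D.σ.onV h ε) = ε :=
  D.rep_eq hε h rfl

theorem onV_injective_of_moved {ε : D.Q.V} (hN : ε ∈ D.N) {h h' : G}
    (e : D.σ.onV h ε = D.σ.onV h' ε) : h = h' := by
  have := D.free ε hN (h'⁻¹ * h) (by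
    rw [D.σ.onV_mul, e, ← D.σ.onV_mul, inv_mul_cancel, D.σ.onV_one])
  exact (inv_mul_eq_one.1 this).symm

theorem pos_onV {ε : D.Q.V} (hε : ε ∈ D.E) (hN : ε ∈ D.N) (h : G) :
    D.pos (D.σ.onV h ε) = h := by
  have := D.onV_pos (D.σ.onV h ε)
  rw [D.rep_onV hε] at this
  exact D.onV_injective_of_moved hN this

theorem rep_of_mem {ε : D.Q.V} (hε : ε ∈ D.E) : D.rep ε = ε := D.rep_eq hε 1 (D.σ.onV_one ε)

/-- Two representatives with a common translate agree, and so do the translating elements if the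
representative is not fixed. -/
theorem onV_inj {ε ε' : D.Q.V} (hε : ε ∈ D.E) (hε' : ε' ∈ D.E) (hN : ε ∈ D.N) {h h' : G}
    (e : D.σ.onV h ε = D.σ.onV h' ε') : ε = ε' ∧ h = h' := by
  have e1 : ε = ε' := by rw [← D.rep_onV hε h, e, D.rep_onV hε']
  subst e1
  exact ⟨rfl, D.onV_injective_of_moved hN e⟩

end general

variable {k : Type z} [Field k] {G : Type w} [CommGroup G] (D : SkewSetting.{u} k G)

theorem char_mul_inv_eq_one {χ b : G →* kˣ} : χ * b⁻¹ = 1 ↔ χ = b := by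
  refine ⟨fun h => MonoidHom.ext fun x => ?_, fun h => MonoidHom.ext fun x => ?_⟩
  · exact mul_inv_eq_one.1 (DFunLike.congr_fun h x)
  · rw [h]
    exact mul_inv_cancel (b x)

theorem fixed_mem_dual_E {ε : D.Q.V} {hN : ε ∉ D.N} {χ : G →* kˣ} :
    Vertex.fixed ε hN χ ∈ D.dual.E ↔ χ = 1 := by
  refine ⟨?_, fun h => Or.inr ⟨ε, hN, by rw [h]⟩⟩
  rintro (⟨_, _, _, e⟩ | ⟨_, _, e⟩)
  · cases e
  · cases e; rfl

theorem fixed_mem_dual_N {ε : D.Q.V} {hN : ε ∉ D.N} {χ : G →* kˣ} :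
    Vertex.fixed ε hN χ ∈ D.dual.N := ⟨ε, hN, χ, rfl⟩

theorem moved_notMem_dual_N {ε : D.Q.V} {hE : ε ∈ D.E} {hN : ε ∈ D.N} :
    Vertex.moved ε hE hN ∉ D.dual.N := by
  rintro ⟨_, _, _, e⟩
  cases e

theorem fixed_eq_onV {ε : D.Q.V} {hN : ε ∉ D.N} (χ : G →* kˣ) :
    Vertex.fixed ε hN χ = D.dual.σ.onV χ (Vertex.fixed ε hN 1) :=
  congrArg (Vertex.fixed ε hN) (mul_one χ).symm

theorem dual_pos_fixed {ε : D.Q.V} {hN : ε ∉ D.N} (χ : G →* kˣ) :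
    D.dual.pos (Vertex.fixed ε hN χ) = χ := by
  rw [fixed_eq_onV]
  exact D.dual.pos_onV (D.fixed_mem_dual_E.2 rfl) D.fixed_mem_dual_N χ

theorem dual_rep_fixed {ε : D.Q.V} {hN : ε ∉ D.N} (χ : G →* kˣ) :
    D.dual.rep (Vertex.fixed ε hN χ) = Vertex.fixed ε hN 1 := by
  rw [fixed_eq_onV]
  exact D.dual.rep_onV (D.fixed_mem_dual_E.2 rfl) χ

variable {D}

/-- The vertices of `(Q_G)_Ĝ`: `η^ε_1 ⊗ 1` for `ε` fixed, and `η^ε ⊗ e_ω` for the other `ε ∈ E`. -/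
theorem dualVertex_cases (v : D.dual.Vertex) :
    (∃ ε hN hE' hN', v = .moved (Vertex.fixed ε hN 1) hE' hN') ∨
      ∃ ε hE hN hN' ω, v = .fixed (Vertex.moved ε hE hN) hN' ω := by
  cases v with
  | moved v hE' hN' =>
    cases v with
    | moved ε hE hN => exact absurd hN' D.moved_notMem_dual_N
    | fixed ε hN χ =>
      obtain rfl := D.fixed_mem_dual_E.1 hE'
      exact Or.inl ⟨ε, hN, hE', hN', rfl⟩
  | fixed v hN' ω =>
    cases v with
    | moved ε hE hN => exact Or.inr ⟨ε, hE, hN, hN', ω, rfl⟩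
    | fixed ε hN χ => exact absurd D.fixed_mem_dual_N hN'

/-- The arrows of `(Q_G)_Ĝ`: they come from the arrows of type (4), (3), (2), (1) of `Q`, with a
prescribed character in the first three cases. -/
theorem dualArrow_cases (a : D.dual.Arrow) :
    (∃ α hs ht hs' ht' hE', a = .one (Arrow.four α hs ht (D.b α hs ht)) hs' ht' hE') ∨
    (∃ α hs ht hE hs' ht' hE' ω, a = .two (Arrow.three α hs ht hE 1) hs' ht' hE' ω) ∨
    (∃ α hs ht hE hs' ht' hE' ω, a = .three (Arrow.two α hs ht hE 1) hs' ht' hE' ω) ∨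
    ∃ α hs ht hE hs' ht' ω, a = .four (Arrow.one α hs ht hE) hs' ht' ω := by
  cases a with
  | one a hs' ht' hE' =>
    cases a with
    | one => exact absurd hs' D.moved_notMem_dual_N
    | two => exact absurd hs' D.moved_notMem_dual_N
    | three => exact absurd ht' D.moved_notMem_dual_N
    | four α hs ht χ =>
      obtain rfl := char_mul_inv_eq_one.1 (D.fixed_mem_dual_E.1 hE')
      exact Or.inl ⟨α, hs, ht, hs', ht', hE', rfl⟩
  | two a hs' ht' hE' ω =>
    cases a with
    | one => exact absurd hs' D.moved_notMem_dual_N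
    | two => exact absurd hs' D.moved_notMem_dual_N
    | three α hs ht hE χ =>
      obtain rfl := D.fixed_mem_dual_E.1 hE'
      exact Or.inr (Or.inl ⟨α, hs, ht, hE, hs', ht', hE', ω, rfl⟩)
    | four => exact absurd D.fixed_mem_dual_N ht'
  | three a hs' ht' hE' ω =>
    cases a with
    | one => exact absurd ht' D.moved_notMem_dual_N
    | two α hs ht hE χ =>
      obtain rfl := D.fixed_mem_dual_E.1 hE'
      exact Or.inr (Or.inr (Or.inl ⟨α, hs, ht, hE, hs', ht', hE', ω, rfl⟩))
    | three => exact absurd ht' D.moved_notMem_dual_N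
    | four => exact absurd D.fixed_mem_dual_N hs'
  | four a hs' ht' ω =>
    cases a with
    | one α hs ht hE => exact Or.inr (Or.inr (Or.inr ⟨α, hs, ht, hE, hs', ht', ω, rfl⟩))
    | two => exact absurd D.fixed_mem_dual_N ht'
    | three => exact absurd D.fixed_mem_dual_N hs'
    | four => exact absurd D.fixed_mem_dual_N hs'

variable (D) [Finite G] [HasEnoughRootsOfUnity k (Monoid.exponent G)]

/-- The isomorphism of the double dual of `G` with `G`. -/
local notation "ev" => CommGroup.monoidHomMonoidHomEquiv G k

theorem phiV_bijective : Function.Bijective D.phiV := by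
  constructor
  · intro v v' h
    rcases dualVertex_cases v with ⟨ε, hN, _, _, rfl⟩ | ⟨ε, hE, hN, _, ω, rfl⟩ <;>
      rcases dualVertex_cases v' with ⟨ε', hN', _, _, rfl⟩ | ⟨ε', hE', hN', _, ω', rfl⟩
    · obtain rfl : ε = ε' := h
      rfl
    · obtain rfl : ε = _ := h
      exact absurd ((D.onV_mem_N _).2 hN') hN
    · have h : D.σ.onV _ ε = ε' := h
      rw [← h, D.onV_mem_N] at hN'
      exact absurd hN hN'
    · obtain ⟨rfl, h'⟩ := D.onV_inj hE hE' hN h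
      obtain rfl := (ev).injective h'
      rfl
  · intro v
    by_cases hN : v ∈ D.N
    · refine ⟨.fixed (.moved (D.rep v) (D.rep_mem_E v) (D.rep_mem_N hN)) D.moved_notMem_dual_N
        ((ev).symm (D.pos v)), ?_⟩
      change D.σ.onV (ev ((ev).symm (D.pos v))) (D.rep v) = v
      rw [MulEquiv.apply_symm_apply, D.onV_pos]
    · exact ⟨.moved (.fixed v hN 1) (D.fixed_mem_dual_E.2 rfl) D.fixed_mem_dual_N, rfl⟩

theorem s_onA_mem_N (h : G) (α : D.Q.A) : D.Q.s (D.σ.onA h α) ∈ D.N ↔ D.Q.s α ∈ D.N := by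
  rw [D.σ.s_onA, D.onV_mem_N]

theorem t_onA_mem_N (h : G) (α : D.Q.A) : D.Q.t (D.σ.onA h α) ∈ D.N ↔ D.Q.t α ∈ D.N := by
  rw [D.σ.t_onA, D.onV_mem_N]

theorem onA_inv_onA (h : G) (α : D.Q.A) : D.σ.onA h (D.σ.onA h⁻¹ α) = α := by
  rw [← D.σ.onA_mul, mul_inv_cancel, D.σ.onA_one]

theorem onV_pos_inv (v : D.Q.V) : D.σ.onV (D.pos v)⁻¹ v = D.rep v := by
  calc D.σ.onV (D.pos v)⁻¹ v = D.σ.onV (D.pos v)⁻¹ (D.σ.onV (D.pos v) (D.rep v)) := by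
        rw [D.onV_pos]
    _ = D.rep v := by rw [← D.σ.onV_mul, inv_mul_cancel, D.σ.onV_one]

theorem phiA_bijective : Function.Bijective D.phiA := by
  constructor
  · intro a a' h
    rcases dualArrow_cases a with ⟨α, hs, ht, _, _, _, rfl⟩ | ⟨α, hs, ht, hE, _, _, _, ω, rfl⟩ |
        ⟨α, hs, ht, hE, _, _, _, ω, rfl⟩ | ⟨α, hs, ht, hE, _, _, ω, rfl⟩ <;>
      rcases dualArrow_cases a' with ⟨α', hs', ht', _, _, _, rfl⟩ |
        ⟨α', hs', ht', hE', _, _, _, ω', rfl⟩ | ⟨α', hs', ht', hE', _, _, _, ω', rfl⟩ |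
        ⟨α', hs', ht', hE', _, _, ω', rfl⟩ <;>
      simp only [phiA] at h
    · subst h
      rfl
    · rw [h, D.t_onA_mem_N] at ht; exact absurd ht' ht
    · rw [h, D.s_onA_mem_N] at hs; exact absurd hs' hs
    · rw [h, D.s_onA_mem_N] at hs; exact absurd hs' hs
    · rw [← h, D.t_onA_mem_N] at ht'; exact absurd ht ht'
    · obtain ⟨-, h'⟩ := D.onV_inj hE hE' ht (by rw [← D.σ.t_onA, ← D.σ.t_onA, h])
      obtain rfl := (ev).injective h'
      obtain rfl := D.σ.onA_injective _ h
      rfl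
    · rw [← D.s_onA_mem_N (ev ω'), ← h, D.s_onA_mem_N] at hs'; exact absurd hs' hs
    · rw [← D.s_onA_mem_N, ← h, D.s_onA_mem_N] at hs'; exact absurd hs' hs
    · rw [← h, D.s_onA_mem_N] at hs'; exact absurd hs hs'
    · rw [← D.s_onA_mem_N (ev ω'), ← h, D.s_onA_mem_N] at hs'; exact absurd hs hs'
    · obtain ⟨-, h'⟩ := D.onV_inj hE hE' hs (by rw [← D.σ.s_onA, ← D.σ.s_onA, h])
      obtain rfl := (ev).injective h'
      obtain rfl := D.σ.onA_injective _ h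
      rfl
    · rw [← D.t_onA_mem_N, ← h, D.t_onA_mem_N] at ht'; exact absurd ht' ht
    · rw [← h, D.s_onA_mem_N] at hs'; exact absurd hs hs'
    · rw [← D.s_onA_mem_N (ev ω'), ← h, D.s_onA_mem_N] at hs'; exact absurd hs hs'
    · rw [← D.t_onA_mem_N (ev ω'), ← h, D.t_onA_mem_N] at ht'; exact absurd ht ht'
    · obtain ⟨-, h'⟩ := D.onV_inj hE hE' ht (by rw [← D.σ.t_onA, ← D.σ.t_onA, h])
      rw [h'] at h
      obtain rfl := D.σ.onA_injective _ h
      obtain rfl := (ev).injective (mul_right_cancel h')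
      rfl
  · intro α
    by_cases hs : D.Q.s α ∈ D.N <;> by_cases ht : D.Q.t α ∈ D.N
    · set p := D.pos (D.Q.t α) with hp
      set β := D.σ.onA p⁻¹ α with hβ
      have htβ : D.Q.t β = D.rep (D.Q.t α) := by
        rw [hβ, D.σ.t_onA, hp, D.onV_pos_inv]
      have hsN : D.Q.s β ∈ D.N := (D.s_onA_mem_N _ _).2 hs
      have htN : D.Q.t β ∈ D.N := (D.t_onA_mem_N _ _).2 ht
      refine ⟨.four (.one β hsN htN (htβ ▸ D.rep_mem_E _)) D.moved_notMem_dual_N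
        D.moved_notMem_dual_N ((ev).symm (p * D.pos (D.Q.s β))), ?_⟩
      simp only [phiA]
      rw [MulEquiv.apply_symm_apply, mul_inv_cancel_right, hβ, D.onA_inv_onA]
    · set p := D.pos (D.Q.s α) with hp
      set β := D.σ.onA p⁻¹ α with hβ
      have hsβ : D.Q.s β = D.rep (D.Q.s α) := by
        rw [hβ, D.σ.s_onA, hp, D.onV_pos_inv]
      have hsN : D.Q.s β ∈ D.N := (D.s_onA_mem_N _ _).2 hs
      have htN : D.Q.t β ∉ D.N := fun h => ht ((D.t_onA_mem_N _ _).1 h)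
      refine ⟨.three (.two β hsN htN (hsβ ▸ D.rep_mem_E _) 1) D.moved_notMem_dual_N
        D.fixed_mem_dual_N (D.fixed_mem_dual_E.2 rfl) ((ev).symm p), ?_⟩
      simp only [phiA]
      rw [MulEquiv.apply_symm_apply, hβ, D.onA_inv_onA]
    · set p := D.pos (D.Q.t α) with hp
      set β := D.σ.onA p⁻¹ α with hβ
      have htβ : D.Q.t β = D.rep (D.Q.t α) := by
        rw [hβ, D.σ.t_onA, hp, D.onV_pos_inv]
      have hsN : D.Q.s β ∉ D.N := fun h => hs ((D.s_onA_mem_N _ _).1 h)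
      have htN : D.Q.t β ∈ D.N := (D.t_onA_mem_N _ _).2 ht
      refine ⟨.two (.three β hsN htN (htβ ▸ D.rep_mem_E _) 1) D.fixed_mem_dual_N
        D.moved_notMem_dual_N (D.fixed_mem_dual_E.2 rfl) ((ev).symm p), ?_⟩
      simp only [phiA]
      rw [MulEquiv.apply_symm_apply, hβ, D.onA_inv_onA]
    · exact ⟨.one (.four α hs ht (D.b α hs ht)) D.fixed_mem_dual_N D.fixed_mem_dual_N
        (D.fixed_mem_dual_E.2 (char_mul_inv_eq_one.2 rfl)), rfl⟩

/-- For an arrow `α` of type (1), the group `Ĝ` acts on `α̃` by evaluation at `t(α)`. -/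
theorem ev_mul_b_inv (ω : (G →* kˣ) →* kˣ) {α : D.Q.A} (hs : D.Q.s α ∈ D.N) (ht : D.Q.t α ∈ D.N)
    (hE : D.Q.t α ∈ D.E) (hs' : D.dual.Q.s (Arrow.one α hs ht hE) ∉ D.dual.N)
    (ht' : D.dual.Q.t (Arrow.one α hs ht hE) ∉ D.dual.N) :
    ev (ω * (D.dual.b (Arrow.one α hs ht hE) hs' ht')⁻¹) = ev ω * (D.pos (D.Q.s α))⁻¹ := by
  rw [map_mul, map_inv]
  refine congrArg (fun x => ev ω * x⁻¹) ?_
  exact (CommGroup.forall_apply_eq_apply_iff G (M := k)).1 fun ψ =>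
    CommGroup.apply_monoidHomMonoidHomEquiv (M := k) ψ _

theorem phiV_s_t (a : D.dual.dual.Q.A) : D.Q.s (D.phiA a) = D.phiV (D.dual.dual.Q.s a) ∧
    D.Q.t (D.phiA a) = D.phiV (D.dual.dual.Q.t a) := by
  have hphi : ∀ (v : D.dual.Q.V) (hE : v ∈ D.dual.E) (hN : v ∈ D.dual.N) (ε : D.Q.V) (h) (χ),
      v = Vertex.fixed ε h χ → D.phiV (.moved v hE hN) = ε := by
    rintro v hE hN ε h χ rfl
    rfl
  rcases dualArrow_cases a with ⟨α, hs, ht, _, _, _, rfl⟩ | ⟨α, hs, ht, hE, _, _, _, ω, rfl⟩ |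
    ⟨α, hs, ht, hE, _, _, _, ω, rfl⟩ | ⟨α, hs, ht, hE, _, _, ω, rfl⟩
  · exact ⟨(hphi _ _ _ _ hs 1 (D.dual_rep_fixed _)).symm, rfl⟩
  · refine ⟨?_, D.σ.t_onA _ α⟩
    exact (D.σ.s_onA _ α).trans (D.fixed _ hs _)
  · refine ⟨D.σ.s_onA _ α, ?_⟩
    exact (D.σ.t_onA _ α).trans (D.fixed _ ht _)
  · refine ⟨?_, ?_⟩
    · refine (D.σ.s_onA _ α).trans ?_
      rw [D.σ.onV_mul, D.onV_pos_inv]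
      rfl
    · refine (D.σ.t_onA _ α).trans ?_
      exact congrArg (fun h => D.σ.onV h (D.Q.t α)) (D.ev_mul_b_inv ω hs ht hE _ _).symm

end SkewSetting

/-! ### Equivalence of the idempotents `f₁` and `θ` -/

namespace SkewQP

open SkewMonoidAlgebra SkewDuality

section idempotents

variable {k : Type z} [Field k] {G : Type w} [Group G] (S : SkewQP.{u} k G)

theorem sum_vert [Fintype S.Q.V] : ∑ v, S.vert v = 1 := by
  have h : ∑ v, (CPA.vertex v : CPA k S.Q) = 1 := by
    ext p
    let ev : CPA k S.Q →+ k := ⟨⟨fun x => x p, rfl⟩, fun _ _ => rfl⟩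
    change ev (∑ v, CPA.vertex v) = _
    rw [_root_.map_sum, Finset.sum_eq_single p.tgt, CPA.one_apply]
    · change CPA.vertex p.tgt p = _
      split_ifs with h
      · exact CPA.vertex_apply _ _ h rfl
      · exact CPA.vertex_eq_zero _ _ fun h' => h h'.2
    · exact fun v _ hv => CPA.vertex_eq_zero v p fun h' => hv h'.1.symm
    · simp
  rw [← map_one S.proj, ← h, _root_.map_sum]
  rfl

theorem smul_arr (h : G) (a : S.Q.A) :
    h • S.arr a = (S.σ.coeff h a : k) • S.arr (S.σ.onA h a) := by
  rw [arr, smul_proj, arr, ← S.proj_smul]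
  exact congrArg S.proj (S.σ.actHom_arrow h a)

theorem arr_onA {a : S.Q.A} (ha : S.Q.s a ∈ S.N ∨ S.Q.t a ∈ S.N) (h : G) :
    S.arr (S.σ.onA h a) = h • S.arr a := by
  rw [smul_arr, S.coeff_eq_one a ha, Units.val_one, one_smul]

end idempotents

variable {k : Type z} [Field k] {G : Type w} [CommGroup G] [Fintype G] [Fintype (Dual k G)]
  (S : SkewQP.{u} k G)

open Classical in
/-- The right-hand factor of `link v`. -/
def linkR (v : S.Q.V) : DoubleSkew k G S.Jac :=
  if v ∈ S.N then grp k S.Jac (S.pos v) else grpIdem S.Jac 1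

open Classical in
/-- The left-hand factor of `colink v`. -/
def colinkL (v : S.Q.V) : DoubleSkew k G S.Jac :=
  if v ∈ S.N then grp k S.Jac (S.pos v)⁻¹ else (Nat.card G : k) • grpIdem S.Jac 1

/-- An element `u_v` of `(ΛG)Ĝ` linking the idempotent `v f₁` with the idempotent of `θ(ΛG)Ĝθ`
corresponding to `v`: `u_v = v f₁ h` if `v = h(ε)` with `ε ∈ E` not fixed, and `u_v = v f₁ e₁` if
`v` is fixed. -/
def link (v : S.Q.V) : DoubleSkew k G S.Jac :=
  coef k G (S.vert v) * dualIdem k S.Jac 1 * S.linkR v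

/-- The element `u_v'` of `(ΛG)Ĝ` inverse to `u_v`: `u_v' = h⁻¹ f₁ v` if `v = h(ε)` with `ε ∈ E` not
fixed, and `u_v' = |G| e₁ f₁ v` if `v` is fixed. -/
def colink (v : S.Q.V) : DoubleSkew k G S.Jac :=
  S.colinkL v * dualIdem k S.Jac 1 * coef k G (S.vert v)

theorem linkR_of_mem {v : S.Q.V} (hv : v ∈ S.N) : S.linkR v = grp k S.Jac (S.pos v) := if_pos hv
theorem linkR_of_notMem {v : S.Q.V} (hv : v ∉ S.N) : S.linkR v = grpIdem S.Jac 1 := if_neg hv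
theorem colinkL_of_mem {v : S.Q.V} (hv : v ∈ S.N) :
    S.colinkL v = grp k S.Jac (S.pos v)⁻¹ := if_pos hv
theorem colinkL_of_notMem {v : S.Q.V} (hv : v ∉ S.N) :
    S.colinkL v = (Nat.card G : k) • grpIdem S.Jac 1 := if_neg hv

variable [IsCyclic G] [HasEnoughRootsOfUnity k (Monoid.exponent G)]

/-- The scalar `c` matters only for `v = w`, since `v w = 0` in `Λ` for distinct vertices `v`, `w`.
The factor `|G|` in `colinkL` makes it `1` for a fixed vertex, as `f₁ e₁ f₁ = |G|⁻¹ f₁`. -/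
theorem dualIdem_linkR_colinkL (v w : S.Q.V) :
    ∃ c : k, dualIdem k S.Jac (1 : G) * (S.linkR v * S.colinkL w) * dualIdem k S.Jac 1 =
      c • dualIdem k S.Jac 1 ∧ (v = w → c = 1) := by
  have hn := card_ne_zero_of_roots k G
  by_cases hv : v ∈ S.N <;> by_cases hw : w ∈ S.N
  · rw [S.linkR_of_mem hv, S.colinkL_of_mem hw, ← map_mul]
    by_cases h : S.pos v * (S.pos w)⁻¹ = 1
    · exact ⟨1, by rw [h, map_one, mul_one, dualIdem_mul_self, one_smul], fun _ => rfl⟩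
    · refine ⟨0, by rw [dualIdem_grp_dualIdem _ h, zero_smul], ?_⟩
      rintro rfl
      exact absurd (mul_inv_cancel _) h
  · refine ⟨1, ?_, fun _ => rfl⟩
    rw [S.linkR_of_mem hv, S.colinkL_of_notMem hw, mul_smul_comm, grp_grpIdem_one, mul_smul_comm,
      smul_mul_assoc, dualIdem_grpIdem_dualIdem, smul_smul, mul_inv_cancel₀ hn]
  · refine ⟨(Nat.card G : k)⁻¹, ?_, ?_⟩
    · rw [S.linkR_of_notMem hv, S.colinkL_of_mem hw, grpIdem_one_grp, dualIdem_grpIdem_dualIdem]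
    · rintro rfl
      exact absurd hw hv
  · refine ⟨1, ?_, fun _ => rfl⟩
    rw [S.linkR_of_notMem hv, S.colinkL_of_notMem hw, mul_smul_comm, grpIdem_one_mul_self,
      mul_smul_comm, smul_mul_assoc, dualIdem_grpIdem_dualIdem, smul_smul, mul_inv_cancel₀ hn]

open Classical in
theorem link_mul_colink (v w : S.Q.V) :
    S.link v * S.colink w =
      if v = w then coef k G (S.vert v) * dualIdem k S.Jac 1 else 0 := by
  obtain ⟨c, hc, hc'⟩ := S.dualIdem_linkR_colinkL v w
  have h : S.link v * S.colink w =
      c • (coef k G (S.vert v * S.vert w) * dualIdem k S.Jac 1) := by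
    calc S.link v * S.colink w = coef k G (S.vert v) * (dualIdem k S.Jac 1 *
          (S.linkR v * S.colinkL w) * dualIdem k S.Jac 1) * coef k G (S.vert w) := by
          simp only [link, colink, mul_assoc]
      _ = _ := by
        rw [hc, mul_smul_comm, smul_mul_assoc, mul_assoc, dualIdem_coef, ← mul_assoc, map_mul]
  rw [h]
  split_ifs with e
  · subst e
    rw [hc' rfl, one_smul, S.vert_mul_self]
  · rw [S.vert_mul_of_ne e, map_zero, zero_mul, smul_zero]

theorem dualIdem_mul_link (v : S.Q.V) : dualIdem k S.Jac 1 * S.link v = S.link v := by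
  rw [link, ← mul_assoc, ← mul_assoc, dualIdem_coef, mul_assoc (coef k G _), dualIdem_mul_self]

theorem vert_mul_link (v : S.Q.V) : coef k G (S.vert v) * S.link v = S.link v := by
  rw [link, ← mul_assoc, ← mul_assoc, ← map_mul, S.vert_mul_self]

theorem vert_mul_link_of_ne {v w : S.Q.V} (h : v ≠ w) : coef k G (S.vert v) * S.link w = 0 := by
  rw [link, ← mul_assoc, ← mul_assoc, ← map_mul, S.vert_mul_of_ne h, map_zero, zero_mul, zero_mul]

theorem colink_mul_vert (v : S.Q.V) : S.colink v * coef k G (S.vert v) = S.colink v := by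
  rw [colink, mul_assoc, ← map_mul, S.vert_mul_self]

theorem colink_mul_vert_of_ne {v w : S.Q.V} (h : v ≠ w) :
    S.colink v * coef k G (S.vert w) = 0 := by
  rw [colink, mul_assoc, ← map_mul, S.vert_mul_of_ne h, map_zero, mul_zero]

/-- The element `u = ∑ᵥ u_v` of `(ΛG)Ĝ`. -/
def totalLink : DoubleSkew k G S.Jac := ∑ᶠ v, S.link v

/-- The element `u' = ∑ᵥ u_v'` of `(ΛG)Ĝ`. -/
def totalColink : DoubleSkew k G S.Jac := ∑ᶠ v, S.colink v

theorem totalLink_mul_totalColink : S.totalLink * S.totalColink = dualIdem k S.Jac 1 := by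
  classical
  have := Fintype.ofFinite S.Q.V
  rw [totalLink, totalColink, finsum_eq_sum_of_fintype, finsum_eq_sum_of_fintype, Finset.sum_mul]
  simp only [Finset.mul_sum, link_mul_colink, Finset.sum_ite_eq, Finset.mem_univ, if_true]
  rw [← Finset.sum_mul, ← _root_.map_sum, sum_vert, map_one, one_mul]

theorem dualIdem_mul_totalLink : dualIdem k S.Jac 1 * S.totalLink = S.totalLink := by
  have := Fintype.ofFinite S.Q.V
  simp only [totalLink, finsum_eq_sum_of_fintype, Finset.mul_sum, dualIdem_mul_link]

theorem vert_mul_totalLink (v : S.Q.V) : coef k G (S.vert v) * S.totalLink = S.link v := by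
  have := Fintype.ofFinite S.Q.V
  rw [totalLink, finsum_eq_sum_of_fintype, Finset.mul_sum,
    Finset.sum_eq_single v (fun w _ h => S.vert_mul_link_of_ne h.symm) (by simp), vert_mul_link]

theorem totalColink_mul_vert (v : S.Q.V) : S.totalColink * coef k G (S.vert v) = S.colink v := by
  have := Fintype.ofFinite S.Q.V
  rw [totalColink, finsum_eq_sum_of_fintype, Finset.sum_mul,
    Finset.sum_eq_single v (fun w _ h => S.colink_mul_vert_of_ne h) (by simp), colink_mul_vert]

/-- The map `a ↦ u' a u` from `Λ` to `(ΛG)Ĝ`. It is multiplicative since `u u' = f₁` commutes with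
`Λ`. -/
def conj : S.Jac →ₙₐ[k] DoubleSkew k G S.Jac where
  toFun a := S.totalColink * coef k G a * S.totalLink
  map_zero' := by simp
  map_add' a b := by rw [map_add, mul_add, add_mul]
  map_smul' c a := by
    rw [coef_smul, mul_smul_comm, smul_mul_assoc]
    rfl
  map_mul' a b := by
    have h : S.totalColink * coef k G a * S.totalLink * (S.totalColink * coef k G b * S.totalLink) =
        S.totalColink * (coef k G a * ((S.totalLink * S.totalColink) * coef k G b) *
          S.totalLink) := by
      simp only [mul_assoc]
    rw [h, totalLink_mul_totalColink, dualIdem_coef, ← mul_assoc (coef k G a), ← map_mul,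
      mul_assoc (coef k G (a * b)), dualIdem_mul_totalLink, mul_assoc]

theorem conj_apply (a : S.Jac) : S.conj a = S.totalColink * coef k G a * S.totalLink := rfl

theorem totalLink_conj_totalColink (a : S.Jac) :
    S.totalLink * S.conj a * S.totalColink = coef k G a * dualIdem k S.Jac 1 := by
  have h : S.totalLink * S.conj a * S.totalColink =
      S.totalLink * S.totalColink * coef k G a * (S.totalLink * S.totalColink) := by
    simp only [conj_apply, mul_assoc]
  rw [h, totalLink_mul_totalColink, dualIdem_coef, mul_assoc, dualIdem_mul_self]

theorem conj_injective : Function.Injective S.conj := fun a b h =>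
  coef_mul_dualIdem_injective (by
    rw [← totalLink_conj_totalColink, ← totalLink_conj_totalColink, h])

theorem conj_one : S.conj 1 = S.totalColink * S.totalLink := by
  rw [conj_apply, map_one, mul_one]

/-- The image of `Λ` is the whole corner given by the idempotent `u'u`. -/
theorem exists_conj_eq {y : DoubleSkew k G S.Jac} (h1 : S.conj 1 * y = y)
    (h2 : y * S.conj 1 = y) : ∃ a, S.conj a = y := by
  obtain ⟨a, ha⟩ := exists_coef_mul_dualIdem (S.totalLink * y * S.totalColink)
  refine ⟨a, ?_⟩
  rw [conj_apply, ← S.dualIdem_mul_totalLink, ← mul_assoc, mul_assoc S.totalColink, ← ha]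
  have h : S.totalColink * (dualIdem k S.Jac 1 * (S.totalLink * y * S.totalColink) *
      dualIdem k S.Jac 1) * S.totalLink =
      S.totalColink * (dualIdem k S.Jac 1 * S.totalLink) * y *
        (S.totalColink * (dualIdem k S.Jac 1 * S.totalLink)) := by
    simp only [mul_assoc]
  rw [h, dualIdem_mul_totalLink, ← conj_one, h1, h2]

/-- The image of an element `x` of `vΛw`: only the summands `u_v'` of `u'` and `u_w` of `u`
contribute. -/
theorem conj_eq {x : S.Jac} {v w : S.Q.V} (h1 : S.vert v * x = x) (h2 : x * S.vert w = x) :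
    S.conj x = S.colinkL v * dualIdem k S.Jac 1 * coef k G x * S.linkR w := by
  have h : S.conj x = S.totalColink * coef k G (S.vert v) * coef k G x *
      (coef k G (S.vert w) * S.totalLink) := by
    have hx : S.vert v * x * S.vert w = x := by rw [h1, h2]
    conv_lhs => rw [← hx, conj_apply]
    simp only [map_mul, mul_assoc]
  rw [h, totalColink_mul_vert, vert_mul_totalLink, colink, link, mul_assoc _ (coef k G (S.vert v)),
    ← map_mul, h1]
  have h' : S.colinkL v * dualIdem k S.Jac 1 * coef k G x *
      (coef k G (S.vert w) * dualIdem k S.Jac 1 * S.linkR w) =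
      S.colinkL v * (dualIdem k S.Jac 1 * (coef k G x * coef k G (S.vert w)) *
        dualIdem k S.Jac 1) * S.linkR w := by
    simp only [mul_assoc]
  rw [h', ← map_mul, h2, dualIdem_coef, mul_assoc (coef k G x), dualIdem_mul_self, ← dualIdem_coef,
    ← mul_assoc]

end SkewQP

/-! ### The inclusion of `(η(ΛG)η)Ĝ` into `(ΛG)Ĝ` -/

namespace SkewDuality

open SkewMonoidAlgebra

section

variable {k : Type*} [Field k] {G : Type*} [CommGroup G] {Λ : Type*} [Ring Λ] [Algebra k Λ]
  [MulSemiringAction G Λ] [SMulCommClass G k Λ]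

variable (k) in
/-- The embedding of the skew group algebra `ΛG` into `(ΛG)Ĝ`. -/
def skew : SkewMonoidAlgebra Λ G →+* DoubleSkew k G Λ :=
  (singleOneRingHom : SkewAlg G Λ →+* DoubleSkew k G Λ).comp
    (RingHomClass.toRingHom (SkewAlg.mk k (G := G) (Λ := Λ)))

theorem skew_apply (y : SkewMonoidAlgebra Λ G) : skew k y = single 1 (SkewAlg.mk k y) := rfl

theorem skew_single (g : G) (a : Λ) : skew k (single g a) = coef k G a * grp k Λ g := by
  have := single_single (k := k) 1 g a
  rwa [map_one, mul_one] at this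

theorem skew_single_one (a : Λ) : skew k (single (1 : G) a) = coef k G a := rfl

theorem skew_charIdem [Fintype G] (χ : G →* kˣ) :
    skew k (SkewSetting.charIdem Λ χ : SkewMonoidAlgebra Λ G) = grpIdem Λ (Dual.mk χ) :=
  (grpIdem_eq χ).symm

theorem single_mk (ψ : Dual k G) (y : SkewMonoidAlgebra Λ G) :
    (single ψ (SkewAlg.mk k y) : DoubleSkew k G Λ) = skew k y * chr Λ ψ := by
  simp [skew_apply, chr_apply, single_mul_single]

theorem chr_mul_skew (ψ : Dual k G) (y : SkewMonoidAlgebra Λ G) :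
    chr Λ ψ * skew k y = single ψ (SkewAlg.mk k (dualHom (k := k) ψ y)) := by
  simp only [skew_apply, chr_apply, single_mul_single, one_mul, mul_one]
  rfl

end

end SkewDuality

namespace SkewQP

open SkewMonoidAlgebra SkewDuality

variable {k : Type z} [Field k] {G : Type w} [CommGroup G] (S : SkewQP.{u} k G)

/-- The inclusion of `(η(ΛG)η)Ĝ` into `(ΛG)Ĝ`. -/
def incl [Finite G] : SkewMonoidAlgebra S.Basic (G →* kˣ) →ₙₐ[k] DoubleSkew k G S.Jac :=
  mapCoeff Dual.mk
    { toFun := fun x : S.Basic => SkewAlg.mk k x.val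
      map_smul' := fun _ _ => rfl
      map_zero' := rfl
      map_add' := fun _ _ => rfl
      map_mul' := fun _ _ => rfl }
    (fun _ _ => rfl)

variable [Finite G]

theorem incl_injective : Function.Injective S.incl :=
  mapCoeff_injective _ _ _ fun _ _ h => Subtype.ext h

theorem incl_single (ψ : G →* kˣ) (x : S.Basic) :
    S.incl (single ψ x) = skew k x.val * chr S.Jac (Dual.mk ψ) :=
  (mapCoeff_single _ _ _ ψ x).trans (single_mk _ _)

theorem incl_single_one (x : S.Basic) : S.incl (single 1 x) = skew k x.val := by
  rw [incl_single, map_one, map_one, mul_one]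

theorem incl_one_mul (x : SkewMonoidAlgebra S.Basic (G →* kˣ)) :
    S.incl 1 * S.incl x = S.incl x :=
  (map_mul S.incl 1 x).symm.trans (congrArg S.incl (one_mul x))

theorem incl_mul_one (x : SkewMonoidAlgebra S.Basic (G →* kˣ)) :
    S.incl x * S.incl 1 = S.incl x :=
  (map_mul S.incl x 1).symm.trans (congrArg S.incl (mul_one x))

/-- The image of the inclusion is the corner of `(ΛG)Ĝ` at `η`: the elements of `Ĝ` fix `η`, so they
commute with it in `(ΛG)Ĝ`. -/
theorem exists_incl_eq (y : DoubleSkew k G S.Jac) :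
    ∃ x, S.incl x = S.incl 1 * y * S.incl 1 := by
  have h1 : S.incl 1 = skew k (S.eta S.vert) := S.incl_single_one 1
  rw [h1]
  induction y using SkewMonoidAlgebra.induction_on with
  | zero => exact ⟨0, by simp⟩
  | add y z hy hz =>
    obtain ⟨a, ha⟩ := hy
    obtain ⟨b, hb⟩ := hz
    exact ⟨a + b, by rw [map_add, ha, hb, mul_add, add_mul]⟩
  | single ψ y =>
    obtain ⟨y, rfl⟩ := (SkewAlg.mk k).surjective y
    have he : S.eta S.vert * S.eta S.vert = S.eta S.vert := S.eta_idem'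
    obtain ⟨z, hz⟩ : ∃ z : S.Basic, z.val = S.eta S.vert * y * S.eta S.vert :=
      ⟨⟨_, S.mem_basic.2 ⟨by rw [← mul_assoc, ← mul_assoc, he], by rw [mul_assoc, he]⟩⟩, rfl⟩
    have he' : dualHom (k := k) ψ (S.eta S.vert) = S.eta S.vert := S.dualHom_eta _
    refine ⟨single (Dual.mk.symm ψ) z, ?_⟩
    rw [incl_single, single_mk, mul_assoc, mul_assoc, chr_mul_skew, he', single_mk, hz,
      MulEquiv.apply_symm_apply, map_mul, map_mul]
    simp only [mul_assoc]

variable [HasEnoughRootsOfUnity k (Monoid.exponent G)] [Fintype (Dual k G)]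

/-- A character `ω` of `Ĝ` is the evaluation at some `h ∈ G`, and its idempotent in `(η(ΛG)η)Ĝ` is
`η f_h = f_h η`. -/
theorem incl_charIdem (ω : (G →* kˣ) →* kˣ) :
    S.incl (SkewSetting.charIdem S.Basic ω) = S.incl 1 *
      dualIdem k S.Jac (CommGroup.monoidHomMonoidHomEquiv G k ω) ∧
    S.incl (SkewSetting.charIdem S.Basic ω) =
      dualIdem k S.Jac (CommGroup.monoidHomMonoidHomEquiv G k ω) * S.incl 1 := by
  let : Fintype (G →* kˣ) := ‹Fintype (Dual k G)›
  have h1 : S.incl 1 = skew k (S.eta S.vert) := S.incl_single_one 1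
  have hcard : Nat.card (G →* kˣ) = Nat.card G :=
    CommGroup.card_monoidHom_of_hasEnoughRootsOfUnity G k
  have h2 : ∀ ψ : Dual k G, chr S.Jac ψ * S.incl 1 = S.incl 1 * chr S.Jac ψ := fun ψ => by
    have : dualHom (k := k) ψ (S.eta S.vert) = S.eta S.vert := S.dualHom_eta _
    rw [h1, chr_mul_skew, this, single_mk]
  have h3 : S.incl (SkewSetting.charIdem S.Basic ω) = S.incl 1 *
      dualIdem k S.Jac (CommGroup.monoidHomMonoidHomEquiv G k ω) := by
    rw [SkewSetting.charIdem, finsum_eq_sum_of_fintype, map_smul, _root_.map_sum, dualIdem,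
      mul_smul_comm, Finset.mul_sum, hcard]
    congr 1
    refine Finset.sum_congr rfl fun ψ _ => ?_
    rw [map_smul, incl_single, mul_smul_comm, h1,
      ← CommGroup.apply_monoidHomMonoidHomEquiv (M := k) ψ ω]
    rfl
  refine ⟨h3, h3.trans ?_⟩
  rw [dualIdem, mul_smul_comm, smul_mul_assoc, Finset.mul_sum, Finset.sum_mul]
  simp only [mul_smul_comm, smul_mul_assoc, h2]

end SkewQP

/-! ### The images of the vertices and arrows -/

namespace SkewQP

open SkewMonoidAlgebra SkewDuality

variable {k : Type z} [Field k] {G : Type w} [CommGroup G] (S : SkewQP.{u} k G)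

section

variable [Finite G] [HasEnoughRootsOfUnity k (Monoid.exponent G)] [Fintype (Dual k G)]

theorem incl_single_mul_charIdem (y : S.Basic) (ω : (G →* kˣ) →* kˣ) :
    S.incl (single 1 y * SkewSetting.charIdem S.Basic ω) =
      skew k y.val * dualIdem k S.Jac (CommGroup.monoidHomMonoidHomEquiv G k ω) := by
  rw [map_mul, (S.incl_charIdem ω).1, ← mul_assoc, incl_mul_one, incl_single_one]

theorem incl_charIdem_mul_single (y : S.Basic) (ω : (G →* kˣ) →* kˣ) :
    S.incl (SkewSetting.charIdem S.Basic ω * single 1 y) =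
      dualIdem k S.Jac (CommGroup.monoidHomMonoidHomEquiv G k ω) * skew k y.val := by
  rw [map_mul, (S.incl_charIdem ω).2, mul_assoc, incl_one_mul, incl_single_one]

end

variable [Fintype G]

theorem skew_basicVert_moved {ε : S.Q.V} (hE : ε ∈ S.E) (hN : ε ∈ S.N) :
    skew k (S.basicVert (.moved ε hE hN)).val = coef k G (S.vert ε) := rfl

theorem skew_basicVert_fixed {ε : S.Q.V} (hN : ε ∉ S.N) :
    skew k (S.basicVert (.fixed ε hN 1)).val = coef k G (S.vert ε) * grpIdem S.Jac 1 := by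
  refine (map_mul (skew k) (single 1 (S.vert ε)) (SkewSetting.charIdem S.Jac 1)).trans ?_
  rw [skew_charIdem, map_one, skew_single_one]

variable [IsCyclic G] [HasEnoughRootsOfUnity k (Monoid.exponent G)] [Fintype (Dual k G)]

theorem conj_vert_fixed {ε : S.Q.V} (hN : ε ∉ S.N) :
    S.conj (S.vert ε) = coef k G (S.vert ε) * grpIdem S.Jac 1 := by
  have h1 : ∀ g : G, g • S.vert ε = ((1 : Dual k G) g : k) • S.vert ε := fun g => by
    rw [S.smul_vert, S.fixed ε hN, Dual.one_apply, Units.val_one, one_smul]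
  rw [S.conj_eq (S.vert_mul_self ε) (S.vert_mul_self ε), S.colinkL_of_notMem hN,
    S.linkR_of_notMem hN, smul_mul_assoc, smul_mul_assoc, smul_mul_assoc, mul_assoc (grpIdem _ _),
    dualIdem_coef, ← mul_assoc, grpIdem_coef h1, one_mul, mul_assoc, mul_assoc,
    ← mul_assoc (grpIdem _ _), grpIdem_dualIdem_grpIdem, mul_smul_comm, smul_smul,
    mul_inv_cancel₀ (card_ne_zero_of_roots k G), one_smul]

theorem conj_vert_moved {ε : S.Q.V} (hE : ε ∈ S.E) (hN : ε ∈ S.N) (h : G) :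
    S.conj (S.vert (S.σ.onV h ε)) = coef k G (S.vert ε) * dualIdem k S.Jac h := by
  rw [S.conj_eq (S.vert_mul_self _) (S.vert_mul_self _),
    S.colinkL_of_mem ((S.onV_mem_N h).2 hN), S.linkR_of_mem ((S.onV_mem_N h).2 hN),
    S.pos_onV hE hN, ← S.smul_vert, grp_inv_dualIdem_coef, mul_assoc, ← map_mul, inv_mul_cancel,
    map_one, mul_one]

theorem incl_vertexElt (v : S.dual.dual.Q.V) :
    S.incl (S.dual.vertexElt S.basicVert v) = S.conj (S.vert (S.phiV v)) := by
  rcases SkewSetting.dualVertex_cases v with ⟨ε, hN, _, _, rfl⟩ | ⟨ε, hE, hN, _, ω, rfl⟩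
  · refine (S.incl_single_one _).trans ?_
    rw [skew_basicVert_fixed]
    exact (S.conj_vert_fixed hN).symm
  · refine (S.incl_single_mul_charIdem _ ω).trans ?_
    rw [skew_basicVert_moved]
    exact (S.conj_vert_moved hE hN _).symm

/-- `θ = u'u`, summing over the orbits: the idempotents `ε f_h` with `h ∈ G` add up to `ε`. -/
theorem incl_theta : S.incl S.theta = S.conj 1 := by
  classical
  have := Fintype.ofFinite S.Q.V
  let q : S.Q.V → DoubleSkew k G S.Jac := fun ε =>
    if ε ∈ S.N then coef k G (S.vert ε) else coef k G (S.vert ε) * grpIdem S.Jac 1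
  have h1 : S.incl S.theta = ∑ᶠ ε ∈ S.E, q ε := by
    let r : S.dual.Q.V → S.Q.V := fun v => match v with
      | .moved ε _ _ => ε
      | .fixed ε _ _ => ε
    have hr : Set.BijOn r S.dual.E S.E := by
      refine ⟨?_, ?_, ?_⟩
      · rintro _ (⟨ε, hE, hN, rfl⟩ | ⟨ε, hN, rfl⟩)
        · exact hE
        · exact S.mem_E_of_fixed hN
      · rintro _ (⟨ε, hE, hN, rfl⟩ | ⟨ε, hN, rfl⟩) _ (⟨ε', hE', hN', rfl⟩ | ⟨ε', hN', rfl⟩) h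
        · obtain rfl : ε = ε' := h
          rfl
        · obtain rfl : ε = ε' := h
          exact absurd hN hN'
        · obtain rfl : ε = ε' := h
          exact absurd hN' hN
        · obtain rfl : ε = ε' := h
          rfl
      · intro ε hE
        by_cases hN : ε ∈ S.N
        · exact ⟨.moved ε hE hN, Or.inl ⟨ε, hE, hN, rfl⟩, rfl⟩
        · exact ⟨.fixed ε hN 1, Or.inr ⟨ε, hN, rfl⟩, rfl⟩
    have hθ : S.incl S.theta = ∑ᶠ v ∈ S.dual.E, S.incl (single 1 (S.basicVert v)) :=
      AddMonoidHom.map_finsum_mem _ (AddMonoidHomClass.toAddMonoidHom S.incl) (Set.toFinite _)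
    rw [hθ]
    refine finsum_mem_eq_of_bijOn r hr ?_
    rintro _ (⟨ε, hE, hN, rfl⟩ | ⟨ε, hN, rfl⟩)
    · exact (S.incl_single_one _).trans (if_pos hN).symm
    · exact (S.incl_single_one _).trans ((S.skew_basicVert_fixed hN).trans (if_neg hN).symm)
  have h2 : S.conj 1 = ∑ v, S.conj (S.vert v) := by rw [← _root_.map_sum, sum_vert]
  rw [h1, h2, finsum_mem_eq_finite_toFinset_sum _ (Set.toFinite S.E),
    ← Finset.sum_fiberwise_of_maps_to (s := Finset.univ) (t := (Set.toFinite S.E).toFinset)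
      (g := S.rep) (fun v _ => by simpa using S.rep_mem_E v)]
  refine Finset.sum_congr rfl fun ε hε => ?_
  have hE : ε ∈ S.E := by simpa using hε
  by_cases hN : ε ∈ S.N
  · have : ∑ h : G, S.conj (S.vert (S.σ.onV h ε)) =
        ∑ v ∈ Finset.univ.filter (fun v => S.rep v = ε), S.conj (S.vert v) := by
      refine Finset.sum_bij (fun h _ => S.σ.onV h ε) ?_ ?_ ?_ (fun _ _ => rfl)
      · exact fun h _ => by simpa using S.rep_onV hE h
      · exact fun h _ h' _ e => S.onV_injective_of_moved hN e
      · intro v hv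
        have hv' : S.rep v = ε := by simpa using hv
        exact ⟨S.pos v, Finset.mem_univ _, by rw [← hv', S.onV_pos]⟩
    rw [← this]
    simp only [q, if_pos hN, S.conj_vert_moved hE hN]
    rw [← Finset.mul_sum, sum_dualIdem, mul_one]
  · have : Finset.univ.filter (fun v => S.rep v = ε) = {ε} := by
      ext v
      simp only [Finset.mem_filter, Finset.mem_univ, true_and, Finset.mem_singleton]
      refine ⟨fun h => ?_, fun h => by rw [h, S.rep_of_mem hE]⟩
      rw [← S.onV_pos v, h, S.fixed ε hN]
    rw [this, Finset.sum_singleton, S.conj_vert_fixed hN]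
    exact if_neg hN

theorem skew_basicArr_one {α : S.Q.A} (hs : S.Q.s α ∈ S.N) (ht : S.Q.t α ∈ S.N)
    (hE : S.Q.t α ∈ S.E) : skew k (S.basicArr (.one α hs ht hE)).val =
      coef k G (S.arr α) * grp k S.Jac (S.pos (S.Q.s α)) := skew_single _ _

theorem skew_basicArr_two {α : S.Q.A} (hs : S.Q.s α ∈ S.N) (ht : S.Q.t α ∉ S.N)
    (hE : S.Q.s α ∈ S.E) (χ : G →* kˣ) : skew k (S.basicArr (.two α hs ht hE χ)).val =
      grpIdem S.Jac (Dual.mk χ) * coef k G (S.arr α) := by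
  refine (map_mul (skew k) (SkewSetting.charIdem S.Jac χ) (single 1 (S.arr α))).trans ?_
  rw [skew_charIdem, skew_single_one]

theorem skew_basicArr_three {α : S.Q.A} (hs : S.Q.s α ∉ S.N) (ht : S.Q.t α ∈ S.N)
    (hE : S.Q.t α ∈ S.E) (χ : G →* kˣ) : skew k (S.basicArr (.three α hs ht hE χ)).val =
      coef k G (S.arr α) * grpIdem S.Jac (Dual.mk χ) := by
  refine (map_mul (skew k) (single 1 (S.arr α)) (SkewSetting.charIdem S.Jac χ)).trans ?_
  rw [skew_charIdem, skew_single_one]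

theorem skew_basicArr_four {α : S.Q.A} (hs : S.Q.s α ∉ S.N) (ht : S.Q.t α ∉ S.N)
    (χ : G →* kˣ) : skew k (S.basicArr (.four α hs ht χ)).val =
      coef k G (S.arr α) * grpIdem S.Jac (Dual.mk χ) := by
  refine (map_mul (skew k) (single 1 (S.arr α)) (SkewSetting.charIdem S.Jac χ)).trans ?_
  rw [skew_charIdem, skew_single_one]

theorem conj_arr (α : S.Q.A) : S.conj (S.arr α) = S.colinkL (S.Q.t α) * dualIdem k S.Jac 1 *
    coef k G (S.arr α) * S.linkR (S.Q.s α) :=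
  S.conj_eq (S.vert_mul_arr α) (S.arr_mul_vert α)

theorem conj_arr_four {α : S.Q.A} (hs : S.Q.s α ∉ S.N) (ht : S.Q.t α ∉ S.N) :
    S.conj (S.arr α) = coef k G (S.arr α) * grpIdem S.Jac (Dual.mk (S.b α hs ht)) *
      chr S.Jac (Dual.mk (S.b α hs ht)) := by
  have hb : ∀ g : G, g • S.arr α = (Dual.mk (S.b α hs ht) g : k) • S.arr α := fun g => by
    rw [S.smul_arr, S.arrow_fixed α hs ht]
    rfl
  rw [conj_arr, S.colinkL_of_notMem ht, S.linkR_of_notMem hs, smul_mul_assoc, smul_mul_assoc,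
    smul_mul_assoc, mul_assoc (grpIdem _ _), dualIdem_coef, ← mul_assoc, grpIdem_coef hb,
    one_mul, mul_assoc, mul_assoc, ← mul_assoc (grpIdem _ _), grpIdem_dualIdem_grpIdem_one,
    mul_smul_comm, smul_smul, mul_inv_cancel₀ (card_ne_zero_of_roots k G), one_smul, mul_assoc]

theorem conj_arr_three {α : S.Q.A} (hs : S.Q.s α ∉ S.N) (ht : S.Q.t α ∈ S.N)
    (hE : S.Q.t α ∈ S.E) (h : G) : S.conj (S.arr (S.σ.onA h α)) =
      dualIdem k S.Jac h * (coef k G (S.arr α) * grpIdem S.Jac 1) := by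
  rw [conj_arr, S.σ.t_onA, S.σ.s_onA, S.fixed _ hs, S.colinkL_of_mem ((S.onV_mem_N h).2 ht),
    S.pos_onV hE ht, S.linkR_of_notMem hs, S.arr_onA (Or.inr ht), grp_inv_dualIdem_coef,
    mul_assoc, grp_grpIdem_one, ← dualIdem_coef, mul_assoc]

/-- The factor `|G|` comes from `colinkL` at the fixed target; it stays because the source is not
fixed, so that no product `e₁ f₁ e₁` arises to cancel it. -/
theorem conj_arr_two {α : S.Q.A} (hs : S.Q.s α ∈ S.N) (ht : S.Q.t α ∉ S.N)
    (hE : S.Q.s α ∈ S.E) (h : G) : S.conj (S.arr (S.σ.onA h α)) =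
      (Nat.card G : k) • (grpIdem S.Jac 1 * coef k G (S.arr α) * dualIdem k S.Jac h) := by
  rw [conj_arr, S.σ.t_onA, S.σ.s_onA, S.fixed _ ht, S.linkR_of_mem ((S.onV_mem_N h).2 hs),
    S.pos_onV hE hs, S.colinkL_of_notMem ht, S.arr_onA (Or.inl hs), smul_mul_assoc,
    smul_mul_assoc, smul_mul_assoc, mul_assoc (grpIdem _ _), dualIdem_coef, mul_assoc,
    mul_assoc, dualIdem_grp, one_mul, ← mul_assoc (coef k G _), ← grp_coef, ← mul_assoc,
    ← mul_assoc, grpIdem_one_grp]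

theorem conj_arr_one {α : S.Q.A} (hs : S.Q.s α ∈ S.N) (ht : S.Q.t α ∈ S.N)
    (hE : S.Q.t α ∈ S.E) (h : G) :
    S.conj (S.arr (S.σ.onA (h * (S.pos (S.Q.s α))⁻¹) α)) =
      coef k G (S.arr α) * grp k S.Jac (S.pos (S.Q.s α)) * dualIdem k S.Jac h := by
  have hs' : S.pos (S.Q.s (S.σ.onA (h * (S.pos (S.Q.s α))⁻¹) α)) = h := by
    rw [S.σ.s_onA, S.σ.onV_mul, S.onV_pos_inv, S.pos_onV (S.rep_mem_E _) (S.rep_mem_N hs)]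
  rw [conj_arr, S.linkR_of_mem ((S.s_onA_mem_N _ _).2 hs), hs', S.σ.t_onA,
    S.colinkL_of_mem ((S.onV_mem_N _).2 ht), S.pos_onV hE ht, S.arr_onA (Or.inl hs),
    grp_inv_dualIdem_coef, mul_assoc, ← map_mul, mul_assoc, dualIdem_grp, ← mul_assoc]
  congr 3 <;> group

theorem incl_arrowElt (a : S.dual.dual.Q.A) :
    S.incl (S.scale a • S.dual.arrowElt S.basicArr a) = S.conj (S.arr (S.phiA a)) := by
  rcases SkewSetting.dualArrow_cases a with ⟨α, hs, ht, _, _, _, rfl⟩ |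
    ⟨α, hs, ht, hE, _, _, _, ω, rfl⟩ | ⟨α, hs, ht, hE, _, _, _, ω, rfl⟩ |
    ⟨α, hs, ht, hE, _, _, ω, rfl⟩
  · have hpos : S.dual.pos (SkewSetting.Vertex.fixed (S.Q.s α) hs (S.b α hs ht)) =
        S.b α hs ht := S.dual_pos_fixed _
    have h1 : S.incl (single (S.dual.pos (SkewSetting.Vertex.fixed (S.Q.s α) hs (S.b α hs ht)))
        (S.basicArr (.four α hs ht (S.b α hs ht)))) = coef k G (S.arr α) *
          grpIdem S.Jac (Dual.mk (S.b α hs ht)) * chr S.Jac (Dual.mk (S.b α hs ht)) := by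
      rw [hpos, incl_single, S.skew_basicArr_four]
    exact (congrArg S.incl (one_smul k _)).trans (h1.trans (S.conj_arr_four hs ht).symm)
  · refine (congrArg S.incl (one_smul k _)).trans
      ((S.incl_charIdem_mul_single _ ω).trans (Eq.trans ?_ (S.conj_arr_three hs ht hE _).symm))
    rw [S.skew_basicArr_three, map_one]
  · refine (map_smul S.incl _ _).trans
      ((congrArg _ (S.incl_single_mul_charIdem _ ω)).trans
        (Eq.trans ?_ (S.conj_arr_two hs ht hE _).symm))
    rw [S.skew_basicArr_two, map_one]
    rfl
  · refine (congrArg S.incl (one_smul k _)).trans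
      ((S.incl_single_mul_charIdem _ ω).trans (Eq.trans ?_ (S.conj_arr_one hs ht hE _).symm))
    rw [S.skew_basicArr_one]

theorem exists_incl_eq_conj (a : S.Jac) : ∃ x, S.incl x = S.conj a := by
  obtain ⟨x, hx⟩ := S.exists_incl_eq (S.conj 1 * S.conj a * S.conj 1)
  refine ⟨x, hx.trans ?_⟩
  have h1 : S.incl 1 * S.conj 1 = S.conj 1 := by rw [← S.incl_theta, incl_one_mul]
  have h2 : S.conj 1 * S.incl 1 = S.conj 1 := by rw [← S.incl_theta, incl_mul_one]
  rw [mul_assoc (S.conj 1), ← mul_assoc, h1, mul_assoc, mul_assoc, h2, ← map_mul, ← map_mul,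
    mul_one, one_mul]

theorem exists_conj_eq_incl (x : SkewMonoidAlgebra S.Basic (G →* kˣ)) (h1 : S.theta * x = x)
    (h2 : x * S.theta = x) : ∃ a, S.conj a = S.incl x :=
  S.exists_conj_eq (by rw [← S.incl_theta, ← map_mul, h1]) (by rw [← S.incl_theta, ← map_mul, h2])

end SkewQP

end

theorem mainTheorem2 {k : Type z} [Field k] {G : Type w} [CommGroup G] [Finite G] [IsCyclic G]
    [HasEnoughRootsOfUnity k (Monoid.exponent G)] (S : SkewQP.{u} k G) :
    (Function.Bijective S.phiV ∧ Function.Bijective S.phiA ∧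
      ∀ a : S.dual.dual.Q.A, S.Q.s (S.phiA a) = S.phiV (S.dual.dual.Q.s a) ∧
        S.Q.t (S.phiA a) = S.phiV (S.dual.dual.Q.t a)) ∧
    ∃ Ψ : S.DoubleBasic ≃ₐ[k] S.Jac,
      (∀ v : S.dual.dual.Q.V, (Ψ.symm (S.vert (S.phiV v))).val =
        S.dual.vertexElt S.basicVert v) ∧
      ∀ a : S.dual.dual.Q.A, (Ψ.symm (S.arr (S.phiA a))).val =
        S.scale a • S.dual.arrowElt S.basicArr a := by
  refine ⟨⟨S.phiV_bijective, S.phiA_bijective, S.phiV_s_t⟩, ?_⟩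
  have := Fintype.ofFinite G
  have : Finite (SkewDuality.Dual k G) := inferInstanceAs (Finite (G →* kˣ))
  have := Fintype.ofFinite (SkewDuality.Dual k G)
  obtain ⟨Ψ, hΨ⟩ := SkewDuality.exists_equiv_cornerAlg (B' := SkewMonoidAlgebra S.Basic (G →* kˣ))
    S.theta_idem S.incl S.incl_injective S.conj S.conj_injective S.incl_theta.symm
    S.exists_incl_eq_conj (fun x h1 h2 => S.exists_conj_eq_incl x h1 h2)
  exact ⟨Ψ, fun v => hΨ _ _ (S.incl_vertexElt v), fun a => hΨ _ _ (S.incl_arrowElt a)⟩
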